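/- Let $\mathbb{CP}^n$ carry the Fubini–Study distance and the Fubini–Study form $\omega_{\sf FS}=\frac{i}{2\pi}\partial\bar\partial\log\|Z\|^2$, and let $\mathscr{M}_n$ be the space of entire curves, i.e. holomorphic maps $f:\mathbb{C}\to\mathbb{CP}^n$, with the topology of uniform convergence on compact sets. A curve $h\in\mathscr{M}_n$ is called universal if for every $g\in\mathscr{M}_n$ and every compact set $K\subset\mathbb{C}$ there is a sequence $(a_i)_{i\geqslant 1}$ of complex numbers such that $h(\cdot+a_i)$ converges to $g$ uniformly on $K$. For $a\in\mathbb{C}$ let $\mathsf{T}_a(f)(z):=f(z+a)$; a curve $h\in\mathscr{M}_n$ is called hypercyclic for $\mathsf{T}_a$ if its orbit $\{\mathsf{T}_a^m(h)\}_{m\geqslant 1}$ is dense in $\mathscr{M}_n$. The Nevanlinna characteristic function of $h$ is $T_h(r):=\int_1^r\frac{dt}{t}\int_{|z|<t}h^*\omega_{\sf FS}$. **Theorem 2.** For any $n\geqslant 1$, any positive continuous function $\phi:\mathbb{R}_+\to\mathbb{R}_+$ with $\lim_{r\to+\infty}\phi(r)=+\infty$, and any countable set $E\subset[0,2\pi)$,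 there exists a universal entire curve $h:\mathbb{C}\to\mathbb{CP}^n$ such that - $T_h(r)\leqslant\phi(r)\cdot\log r$ for all $r\geqslant 1$; - $h$ is hypercyclic for $\mathsf{T}_a$ for every nonzero complex number $a$ with argument in $E$. -/

import Mathlib

open scoped LinearAlgebra.Projectivization InnerProductSpace Topology UniformConvergence

noncomputable section

namespace UniversalCurve

/-! ### The Fubini–Study distance on projective space -/

section Angle

variable {V : Type*} [NormedAddCommGroup V] [InnerProductSpace ℂ V]

/-- The angle in `[0, π/2]` between the complex lines spanned by two nonzero vectors. -/
def lineAngle (v w : V) : ℝ := Real.arccos (‖⟪v, w⟫_ℂ‖ / (‖v‖ * ‖w‖))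

theorem lineAngle_comm (v w : V) : lineAngle v w = lineAngle w v := by
  unfold lineAngle
  rw [norm_inner_symm, mul_comm]

theorem lineAngle_smul_right (v w : V) {c : ℂ} (hc : c ≠ 0) :
    lineAngle v (c • w) = lineAngle v w := by
  unfold lineAngle
  have : ‖c‖ ≠ 0 := norm_ne_zero_iff.2 hc
  rw [inner_smul_right, norm_mul, norm_smul, mul_left_comm, mul_div_mul_left _ _ this]

theorem lineAngle_smul_left (v w : V) {c : ℂ} (hc : c ≠ 0) :
    lineAngle (c • v) w = lineAngle v w := by
  rw [lineAngle_comm, lineAngle_smul_right _ _ hc, lineAngle_comm]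

theorem exists_phase (v w : V) :
    ∃ c : ℂ, c ≠ 0 ∧ ⟪v, c • w⟫_ℂ = (‖⟪v, c • w⟫_ℂ‖ : ℂ) := by
  by_cases h : ⟪v, w⟫_ℂ = 0
  · exact ⟨1, one_ne_zero, by simp [h]⟩
  · refine ⟨(⟪v, w⟫_ℂ)⁻¹, inv_ne_zero h, ?_⟩
    rw [inner_smul_right, inv_mul_cancel₀ h]
    simp

theorem lineAngle_triangle (u v w : V) :
    lineAngle u w ≤ lineAngle u v + lineAngle v w := by
  let _ : InnerProductSpace ℝ V := InnerProductSpace.rclikeToReal ℂ V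
  have hre : ∀ x y : V, ⟪x, y⟫_ℝ = (⟪x, y⟫_ℂ).re := fun x y => rfl
  have hle : ∀ x y : V, lineAngle x y ≤ InnerProductGeometry.angle x y := by
    intro x y
    unfold lineAngle InnerProductGeometry.angle
    apply Real.arccos_le_arccos
    rw [hre]
    exact div_le_div_of_nonneg_right (Complex.re_le_norm _) (by positivity)
  have heq : ∀ x y : V, ⟪x, y⟫_ℂ = (‖⟪x, y⟫_ℂ‖ : ℂ) →
      lineAngle x y = InnerProductGeometry.angle x y := by
    intro x y h
    unfold lineAngle InnerProductGeometry.angle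
    rw [hre, h, Complex.ofReal_re]
    simp
  obtain ⟨c, hc, h1⟩ := exists_phase u v
  obtain ⟨d, hd, h2⟩ := exists_phase (c • v) w
  calc lineAngle u w = lineAngle u (d • w) := (lineAngle_smul_right _ _ hd).symm
    _ ≤ InnerProductGeometry.angle u (d • w) := hle _ _
    _ ≤ InnerProductGeometry.angle u (c • v) + InnerProductGeometry.angle (c • v) (d • w) :=
      InnerProductGeometry.angle_le_angle_add_angle _ _ _
    _ = lineAngle u (c • v) + lineAngle (c • v) (d • w) := by rw [heq _ _ h1, heq _ _ h2]
    _ = lineAngle u v + lineAngle v w := by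
      rw [lineAngle_smul_right _ _ hc, lineAngle_smul_left _ _ hc, lineAngle_smul_right _ _ hd]

end Angle

/-- The complex projective space `ℂℙⁿ`: lines in the Hermitian space `ℂⁿ⁺¹`. -/
abbrev CP (n : ℕ) : Type := ℙ ℂ (EuclideanSpace ℂ (Fin (n + 1)))

/-- The Fubini–Study metric space structure on `ℂℙⁿ`. -/
instance instMetricSpaceCP (n : ℕ) : MetricSpace (CP n) where
  dist p q := lineAngle p.rep q.rep
  dist_self p := by
    have : ‖p.rep‖ ≠ 0 := norm_ne_zero_iff.2 p.rep_nonzero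
    simp only [lineAngle]
    rw [inner_self_eq_norm_sq_to_K, Real.arccos_eq_zero, le_div_iff₀ (by positivity)]
    simp [pow_two]
  dist_comm p q := lineAngle_comm _ _
  dist_triangle p q r := lineAngle_triangle _ _ _
  eq_of_dist_eq_zero := by
    intro p q h
    have hp : ‖p.rep‖ ≠ 0 := norm_ne_zero_iff.2 p.rep_nonzero
    have hq : ‖q.rep‖ ≠ 0 := norm_ne_zero_iff.2 q.rep_nonzero
    have h1 : 1 ≤ ‖⟪p.rep, q.rep⟫_ℂ‖ / (‖p.rep‖ * ‖q.rep‖) := Real.arccos_eq_zero.1 h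
    rw [le_div_iff₀ (by positivity), one_mul] at h1
    have h2 := le_antisymm (norm_inner_le_norm (𝕜 := ℂ) p.rep q.rep) h1
    obtain ⟨r, hr, h3⟩ := (norm_inner_eq_norm_iff p.rep_nonzero q.rep_nonzero).1 h2
    rw [← p.mk_rep, ← q.mk_rep]
    exact ((Projectivization.mk_eq_mk_iff' ℂ _ _ q.rep_nonzero p.rep_nonzero).2
      ⟨r, h3.symm⟩).symm

/-- The distance in terms of arbitrary homogeneous coordinate vectors. -/
theorem dist_mk {n : ℕ} (v w : EuclideanSpace ℂ (Fin (n + 1))) (hv : v ≠ 0) (hw : w ≠ 0) :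
    dist (Projectivization.mk ℂ v hv : CP n) (Projectivization.mk ℂ w hw) =
      Real.arccos (‖⟪v, w⟫_ℂ‖ / (‖v‖ * ‖w‖)) := by
  obtain ⟨a, ha⟩ := Projectivization.exists_smul_eq_mk_rep ℂ v hv
  obtain ⟨b, hb⟩ := Projectivization.exists_smul_eq_mk_rep ℂ w hw
  change lineAngle _ _ = lineAngle v w
  rw [← ha, ← hb]
  exact (lineAngle_smul_left _ _ a.ne_zero).trans (lineAngle_smul_right _ _ b.ne_zero)

/-! ### Entire curves -/

/-- `F` is a holomorphic lift of `h` to `ℂⁿ⁺¹ \ {0}` in a neighbourhood of `z`. -/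
def IsLocalLift {n : ℕ} (F : ℂ → EuclideanSpace ℂ (Fin (n + 1))) (h : ℂ → CP n) (z : ℂ) : Prop :=
  AnalyticAt ℂ F z ∧ ∀ᶠ w in 𝓝 z, ∃ hw : F w ≠ 0, h w = Projectivization.mk ℂ (F w) hw

/-- An entire curve in `ℂℙⁿ`: a holomorphic map `ℂ → ℂℙⁿ`, that is, a map which near every point
has homogeneous coordinates that are holomorphic without common zeros. -/
structure EntireCurve (n : ℕ) where
  toFun : ℂ → CP n
  holomorphic' : ∀ z, ∃ F, IsLocalLift F toFun z

instance (n : ℕ) : CoeFun (EntireCurve n) (fun _ => ℂ → CP n) := ⟨EntireCurve.toFun⟩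

/-- The topology of uniform convergence on compact sets on the space of entire curves. -/
instance (n : ℕ) : TopologicalSpace (EntireCurve n) :=
  TopologicalSpace.induced
    (fun f => UniformOnFun.ofFun {K : Set ℂ | IsCompact K} f.toFun)
    (inferInstance : TopologicalSpace (ℂ →ᵤ[{K : Set ℂ | IsCompact K}] CP n))

/-- The translation operator `T_a(f)(z) = f(z + a)`. -/
def translation {n : ℕ} (a : ℂ) (f : EntireCurve n) : EntireCurve n where
  toFun z := f (z + a)
  holomorphic' z := by
    obtain ⟨F, hF, hev⟩ := f.holomorphic' (z + a)
    have ht : Filter.Tendsto (fun w : ℂ => w + a) (𝓝 z) (𝓝 (z + a)) :=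
      (continuous_id.add continuous_const).tendsto z
    refine ⟨fun w => F (w + a), ?_, ht.eventually hev⟩
    exact AnalyticAt.fun_comp (g := F) (f := fun w : ℂ => w + a) hF
      (analyticAt_id.add analyticAt_const)

/-- `h` is universal: every entire curve is, on every compact set, the uniform limit of a sequence
of translates of `h`. -/
def EntireCurve.IsUniversal {n : ℕ} (h : EntireCurve n) : Prop :=
  ∀ g : EntireCurve n, ∀ K : Set ℂ, IsCompact K →
    ∃ a : ℕ → ℂ, TendstoUniformlyOn (fun i z => h (z + a i)) g Filter.atTop K

/-- `x` is hypercyclic for `T`: the orbit `{T^m x : m ≥ 1}` is dense. -/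
def IsHypercyclicFor {X : Type*} [TopologicalSpace X] (T : X → X) (x : X) : Prop :=
  Dense {y : X | ∃ m : ℕ, 1 ≤ m ∧ y = T^[m] x}

/-! ### The Nevanlinna characteristic -/

section FubiniStudy

variable {V : Type*} [NormedAddCommGroup V] [InnerProductSpace ℂ V]

/-- The squared Fubini–Study length of the image in the tangent space at `[v]` of the tangent
vector `ξ` at `v`. -/
def fsNormSq (v ξ : V) : ℝ := (‖v‖ ^ 2 * ‖ξ‖ ^ 2 - ‖⟪v, ξ⟫_ℂ‖ ^ 2) / ‖v‖ ^ 4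

/-- `fsNormSq` descends to projective space. -/
theorem fsNormSq_smul_add (v ξ : V) (c d : ℂ) (hc : c ≠ 0) :
    fsNormSq (c • v) (c • ξ + d • v) = fsNormSq v ξ := by
  by_cases hv : v = 0
  · simp [fsNormSq, hv]
  have hc' : ‖c‖ ≠ 0 := norm_ne_zero_iff.2 hc
  have hv' : ‖v‖ ≠ 0 := norm_ne_zero_iff.2 hv
  have key : ‖v‖ ^ 2 * ‖c • ξ + d • v‖ ^ 2 - ‖⟪v, c • ξ + d • v⟫_ℂ‖ ^ 2 =
      ‖c‖ ^ 2 * (‖v‖ ^ 2 * ‖ξ‖ ^ 2 - ‖⟪v, ξ⟫_ℂ‖ ^ 2) := by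
    rw [@norm_add_sq ℂ, inner_add_right, inner_smul_right, inner_smul_right, inner_smul_left,
      inner_smul_right, inner_self_eq_norm_sq_to_K, ← inner_conj_symm ξ v, norm_smul, norm_smul]
    generalize ⟪v, ξ⟫_ℂ = s
    simp only [← Complex.normSq_eq_norm_sq, Complex.normSq_apply]
    simp only [mul_pow, ← Complex.normSq_eq_norm_sq, Complex.normSq_apply]
    simp [pow_two]
    ring_nf
  unfold fsNormSq
  rw [inner_smul_left, norm_mul, RCLike.norm_conj, norm_smul, mul_pow, mul_pow, mul_pow, mul_assoc,
    ← mul_sub, key]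
  field_simp

end FubiniStudy

/-- The lift of `h` near `z` that takes values in the affine hyperplane `⟪v, ·⟫ = 1`, where `v`
spans the line `h z`. -/
def affineLift {n : ℕ} (h : ℂ → CP n) (z w : ℂ) : EuclideanSpace ℂ (Fin (n + 1)) :=
  (⟪(h z).rep, (h w).rep⟫_ℂ)⁻¹ • (h w).rep

/-- The density with respect to Lebesgue measure of the pull-back `h^* ω_FS` of the Fubini–Study
form `ω_FS = (i / 2π) ∂∂̄ log ‖Z‖²`. -/
def fsDensity {n : ℕ} (h : ℂ → CP n) (z : ℂ) : ℝ :=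
  Real.pi⁻¹ * fsNormSq (affineLift h z z) (deriv (affineLift h z) z)

/-- The density may be computed from any local lift. -/
theorem fsDensity_eq {n : ℕ} {h : ℂ → CP n} {z : ℂ} {F : ℂ → EuclideanSpace ℂ (Fin (n + 1))}
    (hF : IsLocalLift F h z) :
    fsDensity h z = Real.pi⁻¹ * fsNormSq (F z) (deriv F z) := by
  obtain ⟨hA, hev⟩ := hF
  set v := (h z).rep with hv
  have heq : affineLift h z =ᶠ[𝓝 z] fun w => (⟪v, F w⟫_ℂ)⁻¹ • F w := by
    filter_upwards [hev] with w hw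
    obtain ⟨hw0, hw⟩ := hw
    obtain ⟨a, ha⟩ := Projectivization.exists_smul_eq_mk_rep ℂ (F w) hw0
    have ha' : (a : ℂ) • F w = (h w).rep := by rw [hw]; exact ha
    have ha0 : (a : ℂ) ≠ 0 := a.ne_zero
    rw [affineLift, ← hv, ← ha', inner_smul_right, smul_smul, mul_inv, mul_right_comm,
      inv_mul_cancel₀ ha0, one_mul]
  have hz : ⟪v, F z⟫_ℂ ≠ 0 := by
    obtain ⟨hz0, hz⟩ := hev.self_of_nhds
    obtain ⟨a, ha⟩ := Projectivization.exists_smul_eq_mk_rep ℂ (F z) hz0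
    have ha' : (a : ℂ) • F z = v := by rw [hv, hz]; exact ha
    rw [← ha', inner_smul_left]
    exact mul_ne_zero ((map_ne_zero _).2 a.ne_zero) (inner_self_ne_zero.2 hz0)
  have hd : DifferentiableAt ℂ (fun w => (⟪v, F w⟫_ℂ)⁻¹) z :=
    (((innerSL ℂ v).differentiableAt).comp z hA.differentiableAt).inv hz
  rw [fsDensity, heq.deriv_eq, heq.self_of_nhds, deriv_fun_smul hd hA.differentiableAt,
    fsNormSq_smul_add _ _ _ _ (inv_ne_zero hz)]

/-- The density of an entire curve is continuous. -/
theorem continuous_fsDensity {n : ℕ} (h : EntireCurve n) : Continuous (fsDensity h) := by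
  rw [continuous_iff_continuousAt]
  intro z
  obtain ⟨F, hF⟩ := h.holomorphic' z
  have heq : fsDensity h =ᶠ[𝓝 z] fun w => Real.pi⁻¹ * fsNormSq (F w) (deriv F w) := by
    filter_upwards [hF.1.eventually_analyticAt, hF.2.eventually_nhds] with w h1 h2
    exact fsDensity_eq ⟨h1, h2⟩
  obtain ⟨hz0, -⟩ := hF.2.self_of_nhds
  have h1 := hF.1.continuousAt
  have h2 := hF.1.deriv.continuousAt
  refine ContinuousAt.congr ?_ heq.symm
  unfold fsNormSq
  exact continuousAt_const.mul
    ((((h1.norm.pow 2).mul (h2.norm.pow 2)).sub ((ContinuousAt.inner (𝕜 := ℂ) h1 h2).norm.pow 2)).div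
      (h1.norm.pow 4) (pow_ne_zero 4 (norm_ne_zero_iff.2 hz0)))

/-- The Nevanlinna characteristic `T_h(r) = ∫_1^r (∫_{|z| < t} h^* ω_FS) dt / t`. -/
def EntireCurve.characteristic {n : ℕ} (h : EntireCurve n) (r : ℝ) : ℝ :=
  ∫ t in (1 : ℝ)..r, (∫ z in Metric.ball (0 : ℂ) t, fsDensity h z) / t

end UniversalCurve

end

/-!
The curve is a superposition of rational curves placed very sparsely in the plane.

*Building blocks.* A curve with a polynomial lift `(F₀, …, Fₙ)` in which `F₀` has the largest degree
tends to the base point `[1 : 0 : … : 0]` at infinity, so that its displacement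
`u = (F₁ / F₀, …, Fₙ / F₀)` in the affine chart decays. Such curves approximate every entire curve
on discs: over a disc an entire curve has a holomorphic lift (`EntireCurve.exists_lift_closedBall`),
which is replaced by a Taylor polynomial, and a monomial of high degree and a generic constant are
added (`exists_isDecayingLift_near`).

*Superposition.* Given building blocks with displacements `u₀, u₁, …`, consider `[1 : ∑ uᵢ(z - cᵢ)]`
with centres `cᵢ` far apart. Near `cⱼ` this is the `j`-th block moved by the projective
transformation `[Z₀ : Z'] ↦ [Z₀ : Z' + Z₀ v]`, where `v` is the sum of the other terms and is small;
hence poles do no harm and the curve is close to the `j`-th block there (`SparseFamily.curve`).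
The area over a disc is at most the sum of constants `bⱼ`, one for each block that is met, plus a
small remainder (`SparseFamily.lintegral_fsDensity_le`). Since the `bⱼ` depend only on the blocks,
the centres can be chosen afterwards, so far out that the area over the disc of radius `r`, for
`r ≥ 1`, never exceeds `φ r`. Integrating `dt / t` gives the bound for the characteristic function.

*All step lengths at once.* Only countably many blocks are available, while a direction contains
uncountably many translations. A block therefore shadows its target `g` not at one place but at
finitely many points `s` of a line, whose set is `δ`-dense modulo `t` simultaneously for all
`t ≤ β` (`exists_separated_net_mod`, `EntireCurve.exists_shadowing_lift`). Then, wherever the block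
is placed on its ray, for each `t ≤ β` some multiple of `t` hits the block close to a point of
shadowing. One block for each member of a countable dense set of targets, each direction and each
precision suffices, and universality follows from hypercyclicity in a single direction.
-/

namespace UniversalCurve

open Filter Metric Set Bornology MeasureTheory

/-! ### The Fubini–Study distance and the topology of the space of curves -/

/-- The sine of the angle between the lines spanned by `v` and `w`
is at most `‖v - w‖ / ‖v‖`; the factor `π / 2` compares an angle with its sine. -/
theorem dist_mk_le {n : ℕ} (v w : EuclideanSpace ℂ (Fin (n + 1))) (hv : v ≠ 0) (hw : w ≠ 0) :
    dist (Projectivization.mk ℂ v hv : CP n) (Projectivization.mk ℂ w hw) ≤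
      Real.pi / 2 * (‖v - w‖ / ‖v‖) := by
  have hv' : 0 < ‖v‖ := norm_pos_iff.2 hv
  have hw' : 0 < ‖w‖ := norm_pos_iff.2 hw
  rw [dist_mk]
  set c : ℝ := ‖⟪v, w⟫_ℂ‖ / (‖v‖ * ‖w‖) with hc
  have hc0 : 0 ≤ c := by positivity
  have hcs : ‖⟪v, w⟫_ℂ‖ = c * (‖v‖ * ‖w‖) := by rw [hc]; field_simp
  have h1 : 2 / Real.pi * Real.arccos c ≤ Real.sin (Real.arccos c) :=
    Real.mul_le_sin (Real.arccos_nonneg c) (Real.arccos_le_pi_div_two.2 hc0)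
  rw [Real.sin_arccos] at h1
  have h2 : √(1 - c ^ 2) ≤ ‖v - w‖ / ‖v‖ := by
    apply Real.sqrt_le_iff.2 ⟨by positivity, ?_⟩
    rw [div_pow ‖v - w‖, le_div_iff₀ (by positivity), @norm_sub_sq ℂ]
    have h3 : RCLike.re ⟪v, w⟫_ℂ ≤ c * (‖v‖ * ‖w‖) := by
      rw [← hcs]; exact RCLike.re_le_norm _
    nlinarith [sq_nonneg (‖w‖ - c * ‖v‖)]
  have hpi := Real.pi_pos
  calc Real.arccos c = Real.pi / 2 * (2 / Real.pi * Real.arccos c) := by field_simp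
    _ ≤ _ := by gcongr; exact h1.trans h2

theorem mk_smul_eq {n : ℕ} {v : EuclideanSpace ℂ (Fin (n + 1))} {c : ℂ} (hv : v ≠ 0)
    (hcv : c • v ≠ 0) :
    (Projectivization.mk ℂ (c • v) hcv : CP n) = Projectivization.mk ℂ v hv :=
  (Projectivization.mk_eq_mk_iff' ℂ _ _ hcv hv).2 ⟨c, rfl⟩

theorem continuousAt_mk {n : ℕ} {X : Type*} [TopologicalSpace X] {x : X}
    {F : X → EuclideanSpace ℂ (Fin (n + 1))} {f : X → CP n} (hF : ContinuousAt F x)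
    (hf : ∀ᶠ y in 𝓝 x, ∃ h : F y ≠ 0, f y = Projectivization.mk ℂ (F y) h) :
    ContinuousAt f x := by
  obtain ⟨h0, hx⟩ := hf.self_of_nhds
  rw [ContinuousAt, tendsto_iff_dist_tendsto_zero]
  have hlim : Tendsto (fun y => Real.pi / 2 * (‖F x - F y‖ / ‖F x‖)) (𝓝 x) (𝓝 0) := by
    have : ContinuousAt (fun y => Real.pi / 2 * (‖F x - F y‖ / ‖F x‖)) x := by fun_prop
    simpa [ContinuousAt] using this
  refine tendsto_of_tendsto_of_tendsto_of_le_of_le' tendsto_const_nhds hlim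
    (Eventually.of_forall fun _ => dist_nonneg) ?_
  filter_upwards [hf] with y ⟨hy0, hy⟩
  rw [dist_comm, hx, hy]
  exact dist_mk_le _ _ _ _

/-- Projective space is a continuous image of a separable space. -/
instance instSecondCountableTopologyCP (n : ℕ) : SecondCountableTopology (CP n) := by
  let mk : {v : EuclideanSpace ℂ (Fin (n + 1)) // v ≠ 0} → CP n :=
    fun v => Projectivization.mk ℂ v.1 v.2
  have hc : Continuous mk := continuous_iff_continuousAt.2 fun v =>
    continuousAt_mk continuous_subtype_val.continuousAt
      (Eventually.of_forall fun w => ⟨w.2, rfl⟩)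
  have hs : Function.Surjective mk := fun p => ⟨⟨p.rep, p.rep_nonzero⟩, p.mk_rep⟩
  have : TopologicalSpace.SeparableSpace (CP n) := hs.denseRange.separableSpace hc
  exact UniformSpace.secondCountable_of_separable _

theorem EntireCurve.continuous {n : ℕ} (f : EntireCurve n) : Continuous f := by
  refine continuous_iff_continuousAt.2 fun z => ?_
  obtain ⟨F, hF⟩ := f.holomorphic' z
  exact continuousAt_mk hF.1.continuousAt hF.2

/-- The space of entire curves is separable for uniform convergence on compact sets. -/
theorem EntireCurve.exists_countable_approximation (n : ℕ) :
    ∃ S : Set (EntireCurve n), S.Countable ∧ ∀ g : EntireCurve n, ∀ K : Set ℂ, IsCompact K →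
      ∀ ε > 0, ∃ f ∈ S, ∀ z ∈ K, dist (f z) (g z) < ε := by
  let ι : EntireCurve n → C(ℂ, CP n) := fun f => ⟨f, f.continuous⟩
  obtain ⟨T, hTr, hTc, hTd⟩ := TopologicalSpace.IsSeparable.exists_countable_dense_subset
    (TopologicalSpace.IsSeparable.of_separableSpace (range ι))
  have hι : Function.Injective ι := fun f g h => by
    have h' : f.toFun = g.toFun := congrArg DFunLike.coe h
    cases f; cases g
    congr
  refine ⟨ι ⁻¹' T, hTc.preimage hι, fun g K hK ε hε => ?_⟩
  have hg : ι g ∈ closure T := hTd ⟨g, rfl⟩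
  have hev : ∀ᶠ f : C(ℂ, CP n) in 𝓝 (ι g), ∀ z ∈ K, dist (ι g z) (f z) < ε :=
    Metric.tendstoUniformlyOn_iff.1
      (ContinuousMap.tendsto_iff_forall_isCompact_tendstoUniformlyOn.1 tendsto_id K hK) ε hε
  obtain ⟨f, hfT, hf⟩ := ((mem_closure_iff_frequently.1 hg).and_eventually hev).exists
  obtain ⟨f, rfl⟩ := hTr hfT
  exact ⟨f, hfT, fun z hz => (dist_comm _ _).trans_lt (hf z hz)⟩

theorem EntireCurve.dense_of_approximation {n : ℕ} {S : Set (EntireCurve n)}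
    (hS : ∀ g : EntireCurve n, ∀ K : Set ℂ, IsCompact K → ∀ ε > 0,
      ∃ f ∈ S, ∀ z ∈ K, dist (f z) (g z) < ε) : Dense S := by
  intro g
  have hb := (UniformOnFun.hasBasis_nhds_of_basis ℂ (CP n) {K : Set ℂ | IsCompact K}
    (UniformOnFun.ofFun {K : Set ℂ | IsCompact K} g.toFun) ⟨∅, isCompact_empty⟩
    (fun A hA B hB => ⟨A ∪ B, IsCompact.union hA hB, subset_union_left, subset_union_right⟩)
    Metric.uniformity_basis_dist).comap
      (fun f : EntireCurve n => UniformOnFun.ofFun {K : Set ℂ | IsCompact K} f.toFun)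
  rw [← nhds_induced] at hb
  refine (mem_closure_iff_nhds_basis hb).2 fun i hi => ?_
  obtain ⟨f, hf, hd⟩ := hS g i.1 hi.1 i.2 hi.2
  exact ⟨f, hf, fun z hz => hd z hz⟩

theorem translation_iterate {n : ℕ} (a : ℂ) (h : EntireCurve n) (m : ℕ) (z : ℂ) :
    (translation a)^[m] h z = h (z + m * a) := by
  induction m generalizing z with
  | zero => simp
  | succ m ih =>
    rw [Function.iterate_succ_apply']
    change (translation a)^[m] h (z + a) = _
    rw [ih]
    congr 1
    push_cast
    ring

/-! ### Holomorphic lifts over discs -/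

/-- Two vectors spanning the same line are proportional; normalising by a coordinate that does not
vanish makes the factor explicit. -/
theorem smul_eq_smul_of_mk_eq {n : ℕ} {v w : EuclideanSpace ℂ (Fin (n + 1))} (hv : v ≠ 0)
    (hw : w ≠ 0) (h : (Projectivization.mk ℂ v hv : CP n) = Projectivization.mk ℂ w hw)
    (i : Fin (n + 1)) : w i • v = v i • w := by
  obtain ⟨c, rfl⟩ := (Projectivization.mk_eq_mk_iff' ℂ _ _ hv hw).1 h
  simp [smul_smul, mul_comm]

theorem IsLocalLift.smul {n : ℕ} {F : ℂ → EuclideanSpace ℂ (Fin (n + 1))} {h : ℂ → CP n} {z : ℂ}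
    (hF : IsLocalLift F h z) {e : ℂ → ℂ} (he : AnalyticAt ℂ e z) (hez : e z ≠ 0) :
    IsLocalLift (fun w => e w • F w) h z := by
  refine ⟨he.smul hF.1, ?_⟩
  filter_upwards [hF.2, he.continuousAt.eventually_ne hez] with w ⟨hw, hw'⟩ hew
  exact ⟨smul_ne_zero hew hw, by rw [hw', mk_smul_eq]⟩

theorem IsLocalLift.congr {n : ℕ} {F G : ℂ → EuclideanSpace ℂ (Fin (n + 1))} {h : ℂ → CP n}
    {z : ℂ} (hF : IsLocalLift F h z) (hG : G =ᶠ[𝓝 z] F) : IsLocalLift G h z := by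
  refine ⟨hF.1.congr hG.symm, ?_⟩
  filter_upwards [hF.2, hG] with w hw hGw
  rwa [hGw]

/-- By the identity theorem, a homogeneous coordinate of an entire curve which does not vanish at
one point vanishes identically near no point. -/
theorem IsLocalLift.not_eventually_coord_eq_zero {n : ℕ} {g : EntireCurve n} {i : Fin (n + 1)}
    {z₀ : ℂ} (h0 : (g z₀).rep i ≠ 0) {F : ℂ → EuclideanSpace ℂ (Fin (n + 1))} {z : ℂ}
    (hF : IsLocalLift F g z) : ¬ ∀ᶠ w in 𝓝 z, F w i = 0 := by
  have key : ∀ {F : ℂ → EuclideanSpace ℂ (Fin (n + 1))} {z : ℂ}, IsLocalLift F g z →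
      ∀ᶠ w in 𝓝 z, (F w i = 0 ↔ (g w).rep i = 0) := by
    intro F z hF
    filter_upwards [hF.2] with w ⟨hw, hgw⟩
    obtain ⟨a, ha⟩ := Projectivization.exists_smul_eq_mk_rep ℂ (F w) hw
    have ha' : (a : ℂ) • F w = (g w).rep := by rw [hgw]; exact ha
    rw [← ha']
    simp
  set B : Set ℂ := {z | ∀ᶠ w in 𝓝 z, (g w).rep i = 0} with hB
  have hopen : IsOpen B := isOpen_iff_eventually.2 fun z hz => hz.eventually_nhds
  have hclosed : IsClosed B := by
    refine isClosed_of_closure_subset fun z hz => ?_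
    obtain ⟨F, hF⟩ := g.holomorphic' z
    have hFi : AnalyticAt ℂ (fun w => F w i) z :=
      (EuclideanSpace.proj (𝕜 := ℂ) i : _ →L[ℂ] ℂ).analyticAt _ |>.comp hF.1
    rcases hFi.eventually_eq_zero_or_eventually_ne_zero with h | h
    · filter_upwards [h, key hF] with w h1 h2 using h2.1 h1
    · exfalso
      have h' : ∀ᶠ w in 𝓝 z, w ≠ z → F w i ≠ 0 := eventually_nhdsWithin_iff.1 h
      obtain ⟨w, hwB, hw1, hw2⟩ := ((mem_closure_iff_frequently.1 hz).and_eventually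
        (h'.eventually_nhds.and (key hF).eventually_nhds)).exists
      have h3 : ∀ᶠ y in 𝓝 w, y = z := by
        filter_upwards [hwB, hw1, hw2] with y h1 h2 h3
        by_contra hyz
        exact h2 hyz (h3.2 h1)
      have h4 : ∀ᶠ y in 𝓝[≠] w, y = w := by
        obtain rfl : w = z := h3.self_of_nhds
        exact nhdsWithin_le_nhds h3
      obtain ⟨y, hy1, hy2⟩ := (h4.and eventually_mem_nhdsWithin).exists
      exact hy2 hy1
  intro hz
  have hzB : z ∈ B := by
    filter_upwards [hz, key hF] with w h1 h2 using h2.1 h1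
  have huniv : B = univ := IsClopen.eq_univ ⟨hclosed, hopen⟩ ⟨z, hzB⟩
  have : z₀ ∈ B := huniv ▸ mem_univ z₀
  exact h0 this.self_of_nhds

/-- Over every disc an entire curve has a holomorphic lift. Local lifts are normalised so that a
fixed coordinate is a power `(w - z) ^ m`; the finitely many exponents `m ≠ 0` in the disc are the
zeros of the polynomial by which the affine coordinates are multiplied to clear the poles. -/
theorem EntireCurve.exists_lift_closedBall {n : ℕ} (g : EntireCurve n) (R : ℝ) :
    ∃ G : ℂ → EuclideanSpace ℂ (Fin (n + 1)), ∀ z ∈ closedBall (0 : ℂ) R, IsLocalLift G g z := by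
  obtain ⟨i, hi⟩ : ∃ i, (g 0).rep i ≠ 0 := by
    by_contra! h
    exact (g 0).rep_nonzero (by ext i; simpa using h i)
  have hloc : ∀ z, ∃ (m : ℕ) (F : ℂ → EuclideanSpace ℂ (Fin (n + 1))), IsLocalLift F g z ∧
      ∀ᶠ w in 𝓝 z, F w i = (w - z) ^ m := by
    intro z
    obtain ⟨F, hF⟩ := g.holomorphic' z
    have hFi : AnalyticAt ℂ (fun w => F w i) z :=
      (EuclideanSpace.proj (𝕜 := ℂ) i : _ →L[ℂ] ℂ).analyticAt _ |>.comp hF.1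
    obtain ⟨m, e, he, he0, heq⟩ :=
      hFi.exists_eventuallyEq_pow_smul_nonzero_iff.2 (hF.not_eventually_coord_eq_zero hi)
    refine ⟨m, fun w => (e w)⁻¹ • F w, hF.smul (he.inv he0) (inv_ne_zero he0), ?_⟩
    filter_upwards [heq, he.continuousAt.eventually_ne he0] with w h1 h2
    simp [h1]
    field_simp
  choose m F hF hFi using hloc
  have hisol : ∀ z, ∀ᶠ w in 𝓝 z, w ≠ z → m w = 0 ∧ (w - z) ^ m z • F w w = F z w := by
    intro z
    filter_upwards [hFi z, (hF z).2] with w h1 ⟨h2, h3⟩ hwz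
    have h4 := (hFi w).self_of_nhds
    obtain ⟨h5, h6⟩ := (hF w).2.self_of_nhds
    have h7 := smul_eq_smul_of_mk_eq h5 h2 (h6.symm.trans h3) i
    rw [h1, h4, sub_self] at h7
    have hm : m w = 0 := by
      by_contra hm
      rw [zero_pow hm, zero_smul] at h7
      exact smul_ne_zero (pow_ne_zero _ (sub_ne_zero.2 hwz)) h5 h7
    rw [hm, pow_zero, one_smul] at h7
    exact ⟨hm, h7⟩
  have hfin : {z ∈ closedBall (0 : ℂ) R | m z ≠ 0}.Finite := by
    obtain ⟨t, -, ht⟩ := (isCompact_closedBall (0 : ℂ) R).elim_nhds_subcover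
      (fun z => {w | w ≠ z → m w = 0 ∧ (w - z) ^ m z • F w w = F z w}) fun z _ => hisol z
    refine t.finite_toSet.subset fun w ⟨hw, hmw⟩ => ?_
    obtain ⟨z, hz, hwz⟩ := mem_iUnion₂.1 (ht hw)
    by_cases h : w = z
    · simpa [h] using hz
    · exact absurd (hwz h).1 hmw
  set Z : Finset ℂ := hfin.toFinset with hZ
  refine ⟨fun w => (∏ a ∈ Z.erase w, (w - a) ^ m a) • F w w, fun z hz => ?_⟩
  refine IsLocalLift.congr ((hF z).smul (e := fun w => ∏ a ∈ Z.erase z, (w - a) ^ m a) ?_ ?_) ?_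
  · fun_prop
  · refine Finset.prod_ne_zero_iff.2 fun a ha => pow_ne_zero _ (sub_ne_zero.2 ?_)
    exact (Finset.ne_of_mem_erase ha).symm
  · filter_upwards [hisol z] with w hw
    by_cases hwz : w = z
    · rw [hwz]
    obtain ⟨hm, hw⟩ := hw hwz
    have hwZ : w ∉ Z := by simp [hZ, hm]
    rw [Finset.erase_eq_of_notMem hwZ, ← hw, smul_smul]
    congr 1
    by_cases hzZ : z ∈ Z
    · rw [Finset.prod_erase_mul _ _ hzZ]
    · have hmz : m z = 0 := by
        by_contra h
        exact hzZ (by simp only [hZ, Finite.mem_toFinset]; exact ⟨hz, h⟩)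
      rw [Finset.erase_eq_of_notMem hzZ, hmz, pow_zero, mul_one]

/-! ### Polynomial approximation -/

/-- Taylor polynomials of a vector-valued holomorphic function. -/
theorem exists_polynomial_approximation {V : Type*} [NormedAddCommGroup V] [NormedSpace ℂ V]
    [CompleteSpace V] {G : ℂ → V} {r R : ℝ} (hrR : r < R)
    (hG : DifferentiableOn ℂ G (closedBall 0 R)) {ε : ℝ} (hε : 0 < ε) :
    ∃ (N : ℕ) (a : ℕ → V), ∀ z ∈ closedBall (0 : ℂ) r,
      ‖(∑ k ∈ Finset.range N, z ^ k • a k) - G z‖ ≤ ε := by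
  rcases lt_or_ge r 0 with hr | hr
  · exact ⟨0, 0, fun z hz => absurd hz (by simp [closedBall_eq_empty.2 hr])⟩
  lift R to NNReal using hr.trans hrR.le
  have hR : 0 < R := by exact_mod_cast hr.trans_lt hrR
  obtain ⟨s, hrs, hsR⟩ := exists_between hrR
  lift s to NNReal using hr.trans hrs.le
  have h := (hG.hasFPowerSeriesOnBall hR).tendstoUniformlyOn (r' := s) (by exact_mod_cast hsR)
  obtain ⟨N, hN⟩ := (Metric.tendstoUniformlyOn_iff.1 h ε hε).exists
  refine ⟨N, (cauchyPowerSeries G 0 R).coeff, fun z hz => ?_⟩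
  have h1 := hN z (closedBall_subset_ball hrs hz)
  rw [dist_comm, dist_eq_norm, zero_add, FormalMultilinearSeries.partialSum] at h1
  simp only [FormalMultilinearSeries.apply_eq_pow_smul_coeff] at h1
  exact h1.le

/-! ### Curves that tend to the base point at infinity -/

/-- The first basis vector of `ℂⁿ⁺¹`; it spans the base point `[1 : 0 : … : 0]`. -/
noncomputable def baseVec (n : ℕ) : EuclideanSpace ℂ (Fin (n + 1)) := EuclideanSpace.single 0 1

/-- The displacement from the base point in the affine chart `Z₀ ≠ 0`: if `F = (F₀, …, Fₙ)` this is
`(0, F₁ / F₀, …, Fₙ / F₀)`. Its value where `F₀` vanishes carries no meaning. -/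
noncomputable def affinePart {n : ℕ} (F : ℂ → EuclideanSpace ℂ (Fin (n + 1))) (z : ℂ) :
    EuclideanSpace ℂ (Fin (n + 1)) :=
  (F z 0)⁻¹ • F z - baseVec n

/-- `F` is a global lift, without zeros, of an entire curve which tends to the base point
`[1 : 0 : … : 0]` at least as fast as `1 / |z|` at infinity. -/
structure IsDecayingLift {n : ℕ} (F : ℂ → EuclideanSpace ℂ (Fin (n + 1))) : Prop where
  differentiable : Differentiable ℂ F
  ne_zero : ∀ z, F z ≠ 0
  decay : ∃ C : ℝ, ∀ᶠ z in cobounded ℂ, F z 0 ≠ 0 ∧ ‖z‖ * ‖affinePart F z‖ ≤ C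

theorem norm_baseVec (n : ℕ) : ‖baseVec n‖ = 1 := by simp [baseVec]

theorem smul_baseVec_add_affinePart {n : ℕ} {F : ℂ → EuclideanSpace ℂ (Fin (n + 1))} {z : ℂ}
    (h : F z 0 ≠ 0) : F z 0 • (baseVec n + affinePart F z) = F z := by
  simp [affinePart, smul_smul, h]

theorem differentiableAt_affinePart {n : ℕ} {F : ℂ → EuclideanSpace ℂ (Fin (n + 1))} {z : ℂ}
    (hF : DifferentiableAt ℂ F z) (h : F z 0 ≠ 0) : DifferentiableAt ℂ (affinePart F) z := by
  have h0 : DifferentiableAt ℂ (fun w => F w 0) z :=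
    differentiableAt_euclidean.1 hF 0
  exact ((h0.inv h).smul hF).sub_const _

/-- Any entire vector function is approximated on discs by decaying lifts: Taylor polynomials are
perturbed by monomials of higher degree, which dominate at infinity, and by a generic constant,
which removes common zeros. -/
theorem exists_isDecayingLift_near {n : ℕ} (hn : 1 ≤ n) {H : ℂ → EuclideanSpace ℂ (Fin (n + 1))}
    (hH : Differentiable ℂ H) (R : ℝ) {ε : ℝ} (hε : 0 < ε) :
    ∃ F, IsDecayingLift F ∧ ∀ z ∈ closedBall (0 : ℂ) R, ‖F z - H z‖ ≤ ε := by
  obtain ⟨N, a, ha⟩ := exists_polynomial_approximation (lt_add_one R) hH.differentiableOn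
    (half_pos hε)
  set p : ℂ → EuclideanSpace ℂ (Fin (n + 1)) := fun z => ∑ k ∈ Finset.range N, z ^ k • a k with hp
  set M : ℝ := max R 1 with hM
  have hM1 : 1 ≤ M := le_max_right _ _
  set e : ℝ := ε / (8 * M ^ (N + 1)) with he
  have he0 : 0 < e := by positivity
  have heM : e * M ^ (N + 1) = ε / 8 := by rw [he]; field_simp
  let i : Fin (n + 1) := ⟨1, by omega⟩
  have hi : i ≠ 0 := by simp [i, Fin.ext_iff]
  let q : Polynomial ℂ := ∑ k ∈ Finset.range N, Polynomial.C (a k i) * Polynomial.X ^ k +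
    Polynomial.C (e : ℂ) * Polynomial.X ^ N
  have hq : q ≠ 0 := by
    intro h
    have h1 := congrArg (fun r => Polynomial.coeff r N) h
    simp [q, Polynomial.coeff_X_pow] at h1
    exact he0.ne' h1
  have hqe : ∀ z, q.eval z = p z i + e * z ^ N := by
    intro z
    have h1 : p z i = ∑ k ∈ Finset.range N, a k i * z ^ k := by
      simp only [hp, WithLp.ofLp_sum, WithLp.ofLp_smul, Finset.sum_apply, Pi.smul_apply,
        smul_eq_mul]
      exact Finset.sum_congr rfl fun k _ => mul_comm _ _
    rw [h1, Polynomial.eval_add, Polynomial.eval_finsetSum]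
    simp only [Polynomial.eval_mul, Polynomial.eval_C, Polynomial.eval_pow, Polynomial.eval_X]
  -- The constant `η` avoids the finitely many values that would create a common zero.
  obtain ⟨η, hη, hηq⟩ : ∃ η ∈ Ioo (0 : ℝ) (ε / 8),
      (η : ℂ) ∉ (q.roots.toFinset.image fun z => -(p z 0 + e * z ^ (N + 1))) := by
    have hinf : (Complex.ofReal '' Ioo (0 : ℝ) (ε / 8)).Infinite :=
      (Ioo_infinite (by positivity)).image Complex.ofReal_injective.injOn
    obtain ⟨_, ⟨η, hη, rfl⟩, h⟩ := hinf.exists_notMem_finset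
      (q.roots.toFinset.image fun z => -(p z 0 + e * z ^ (N + 1)))
    exact ⟨η, hη, h⟩
  set F : ℂ → EuclideanSpace ℂ (Fin (n + 1)) := fun z =>
    p z + ((e : ℂ) * z ^ N) • EuclideanSpace.single i 1 +
      ((e : ℂ) * z ^ (N + 1) + η) • baseVec n with hF
  have hF0 : ∀ z, F z 0 = p z 0 + e * z ^ (N + 1) + η := by
    intro z
    simp [hF, baseVec, hi.symm, add_assoc]
  refine ⟨F, ⟨by fun_prop, fun z hz => ?_, ?_⟩, fun z hz => ?_⟩
  · have h1 : F z i = 0 := by rw [hz]; rfl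
    have h0 : F z 0 = 0 := by rw [hz]; rfl
    rw [hF0] at h0
    have h2 : q.eval z = 0 := by
      rw [hqe, ← h1]
      simp [hF, baseVec, hi]
    refine hηq (Finset.mem_image.2 ⟨z, ?_, ?_⟩)
    · simpa [hq] using h2
    · linear_combination -h0
  · set A : ℝ := ∑ k ∈ Finset.range N, ‖a k‖ with hA
    have hA0 : 0 ≤ A := by positivity
    have hpA : ∀ z : ℂ, 1 ≤ ‖z‖ → ‖p z‖ ≤ A * ‖z‖ ^ N := by
      intro z hz
      rw [hp, hA, Finset.sum_mul]
      refine norm_sum_le_of_le _ fun k hk => ?_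
      rw [norm_smul, norm_pow, mul_comm]
      refine mul_le_mul_of_nonneg_left (pow_le_pow_right₀ hz ?_) (norm_nonneg _)
      exact (Finset.mem_range.1 hk).le
    refine ⟨2 * (2 * A + e) / e, ?_⟩
    filter_upwards [(eventually_cobounded_le_norm (E := ℂ) (max 1 (2 * (A + η) / e)))] with z hz
    have hz1 : 1 ≤ ‖z‖ := (le_max_left _ _).trans hz
    have hz2 : 2 * (A + η) ≤ ‖z‖ * e := (div_le_iff₀ he0).1 ((le_max_right _ _).trans hz)
    have hzN : 1 ≤ ‖z‖ ^ N := one_le_pow₀ hz1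
    have hp1 := hpA z hz1
    have hp0 : ‖p z 0‖ ≤ ‖p z‖ := PiLp.norm_apply_le _ _
    have hlow : e / 2 * ‖z‖ ^ (N + 1) ≤ ‖F z 0‖ := by
      have h1 : ‖(e : ℂ) * z ^ (N + 1)‖ ≤ ‖F z 0‖ + ‖p z 0‖ + ‖(η : ℂ)‖ := by
        have : (e : ℂ) * z ^ (N + 1) = F z 0 - p z 0 - η := by rw [hF0]; ring
        rw [this]
        exact (norm_sub_le _ _).trans (by gcongr; exact norm_sub_le _ _)
      rw [norm_mul, norm_pow, Complex.norm_real, Complex.norm_real, Real.norm_of_nonneg he0.le,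
        Real.norm_of_nonneg hη.1.le] at h1
      have h2 : η ≤ η * ‖z‖ ^ N := le_mul_of_one_le_right hη.1.le hzN
      have h3 : (2 * (A + η)) * ‖z‖ ^ N ≤ (‖z‖ * e) * ‖z‖ ^ N := by gcongr
      rw [pow_succ] at h1 ⊢
      nlinarith
    have hpos : 0 < ‖F z 0‖ := lt_of_lt_of_le (by positivity) hlow
    have hne : F z 0 ≠ 0 := norm_pos_iff.1 hpos
    refine ⟨hne, ?_⟩
    have h1 : ‖F z 0‖ * ‖affinePart F z‖ ≤ (2 * A + e) * ‖z‖ ^ N := by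
      have h2 : F z 0 • affinePart F z =
          p z - p z 0 • baseVec n + ((e : ℂ) * z ^ N) • EuclideanSpace.single i 1 := by
        rw [affinePart, smul_sub, smul_smul, mul_inv_cancel₀ hne, one_smul, hF0, hF]
        module
      rw [← norm_smul, h2]
      calc _ ≤ ‖p z‖ + ‖p z 0 • baseVec n‖ +
            ‖((e : ℂ) * z ^ N) • (EuclideanSpace.single i 1 : EuclideanSpace ℂ (Fin (n + 1)))‖ :=
            (norm_add_le _ _).trans (by gcongr; exact norm_sub_le _ _)
        _ = ‖p z‖ + ‖p z 0‖ + e * ‖z‖ ^ N := by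
            rw [norm_smul, norm_smul, norm_baseVec]
            simp [abs_of_pos he0]
        _ ≤ _ := by linarith
    rw [le_div_iff₀ he0]
    have h3 : ‖z‖ * (e / 2 * ‖z‖ ^ N) * ‖affinePart F z‖ ≤ (2 * A + e) * ‖z‖ ^ N := by
      refine le_trans ?_ h1
      gcongr
      rw [pow_succ] at hlow
      linarith
    have h4 : (‖z‖ * ‖affinePart F z‖ * e) * ‖z‖ ^ N ≤ (2 * (2 * A + e)) * ‖z‖ ^ N := by
      linarith
    exact le_of_mul_le_mul_right h4 (by positivity)
  · have hzM : ‖z‖ ≤ M := (mem_closedBall_zero_iff.1 hz).trans (le_max_left _ _)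
    have h1 : F z - H z = (p z - H z) + (((e : ℂ) * z ^ N) • EuclideanSpace.single i 1 +
      ((e : ℂ) * z ^ (N + 1) + η) • baseVec n) := by rw [hF]; module
    have h2 : e * ‖z‖ ^ N ≤ ε / 8 := by
      rw [← heM]
      gcongr
      exact (pow_le_pow_left₀ (norm_nonneg _) hzM N).trans (pow_le_pow_right₀ hM1 (by omega))
    have h3 : e * ‖z‖ ^ (N + 1) ≤ ε / 8 := by
      rw [← heM]
      gcongr
    have h4 : ‖((e : ℂ) * z ^ N) • (EuclideanSpace.single i 1 : EuclideanSpace ℂ (Fin (n + 1)))‖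
        = e * ‖z‖ ^ N := by
      rw [norm_smul]
      simp [abs_of_pos he0]
    have h5 : ‖((e : ℂ) * z ^ (N + 1) + η) • baseVec n‖ ≤ e * ‖z‖ ^ (N + 1) + η := by
      rw [norm_smul, norm_baseVec, mul_one]
      refine (norm_add_le _ _).trans_eq ?_
      simp [abs_of_pos he0, abs_of_pos hη.1]
    rw [h1]
    have h6 := norm_add_le (p z - H z) (((e : ℂ) * z ^ N) • EuclideanSpace.single i 1 +
      ((e : ℂ) * z ^ (N + 1) + η) • baseVec n)
    have h7 := norm_add_le (((e : ℂ) * z ^ N) •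
      (EuclideanSpace.single i 1 : EuclideanSpace ℂ (Fin (n + 1))))
      (((e : ℂ) * z ^ (N + 1) + η) • baseVec n)
    have h8 := ha z hz
    have h9 := hη.2
    linarith

theorem IsDecayingLift.tendsto_affinePart {n : ℕ} {F : ℂ → EuclideanSpace ℂ (Fin (n + 1))}
    (hF : IsDecayingLift F) : Tendsto (affinePart F) (cobounded ℂ) (𝓝 0) := by
  obtain ⟨C, hC⟩ := hF.decay
  have hlim : Tendsto (fun z : ℂ => C / ‖z‖) (cobounded ℂ) (𝓝 0) :=
    tendsto_norm_cobounded_atTop.const_div_atTop C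
  refine squeeze_zero_norm' ?_ hlim
  filter_upwards [hC, eventually_cobounded_le_norm (E := ℂ) 1] with z hz hz1
  rw [le_div_iff₀ (by positivity), mul_comm]
  exact hz.2

theorem IsDecayingLift.eventually_ne_zero {n : ℕ} {F : ℂ → EuclideanSpace ℂ (Fin (n + 1))}
    (hF : IsDecayingLift F) : ∀ᶠ z in cobounded ℂ, F z 0 ≠ 0 := by
  obtain ⟨C, hC⟩ := hF.decay
  exact hC.mono fun z hz => hz.1

/-- Cauchy's estimate on the disc of radius `|z| / 2` around `z`. -/
theorem IsDecayingLift.exists_deriv_affinePart_le {n : ℕ}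
    {F : ℂ → EuclideanSpace ℂ (Fin (n + 1))} (hF : IsDecayingLift F) :
    ∃ C : ℝ, 0 ≤ C ∧ ∀ᶠ z in cobounded ℂ, ‖deriv (affinePart F) z‖ ≤ C / ‖z‖ ^ 2 := by
  obtain ⟨C, hC⟩ := hF.decay
  obtain ⟨ρ, hρ⟩ := (hasBasis_cobounded_norm (E := ℂ)).eventually_iff.1 hC |>.imp fun ρ h => h.2
  have hC0 : 0 ≤ C := by
    obtain ⟨z, hz⟩ := hC.exists
    exact le_trans (by positivity) hz.2
  refine ⟨4 * C, by positivity, ?_⟩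
  filter_upwards [eventually_cobounded_le_norm (E := ℂ) (max 1 (2 * ρ))] with z hz
  have hz1 : 1 ≤ ‖z‖ := (le_max_left _ _).trans hz
  have hz2 : 2 * ρ ≤ ‖z‖ := (le_max_right _ _).trans hz
  have hw : ∀ w ∈ closedBall z (‖z‖ / 2), ‖z‖ / 2 ≤ ‖w‖ := by
    intro w hw
    rw [mem_closedBall, dist_eq_norm] at hw
    have := norm_sub_norm_le z w
    rw [norm_sub_rev] at this
    linarith
  have hw' : ∀ w ∈ closedBall z (‖z‖ / 2), F w 0 ≠ 0 ∧ ‖w‖ * ‖affinePart F w‖ ≤ C := fun w hwz =>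
    hρ (by have := hw w hwz; simp only [mem_ofPred_eq]; linarith)
  have hd : DiffContOnCl ℂ (affinePart F) (ball z (‖z‖ / 2)) := by
    refine DifferentiableOn.diffContOnCl fun w hwz => ?_
    exact (differentiableAt_affinePart (hF.differentiable w)
      (hw' w (closure_ball_subset_closedBall hwz)).1).differentiableWithinAt
  have h := Complex.norm_deriv_le_of_forall_mem_sphere_norm_le (C := C / (‖z‖ / 2))
    (by positivity) hd fun w hws => by
      have h1 := hw w (sphere_subset_closedBall hws)
      have h2 := (hw' w (sphere_subset_closedBall hws)).2
      rw [le_div_iff₀ (by positivity), mul_comm]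
      exact (mul_le_mul_of_nonneg_right h1 (norm_nonneg _)).trans h2
  refine h.trans_eq ?_
  field_simp
  ring

/-! ### Well-separated sets that are dense modulo every period -/

/-- For every bound `β` on the period and every `δ > 0` there is a number `N` such that, for any
prescribed separation `L`, some `L`-separated family of `N ^ 2` reals is `δ`-dense modulo `t` for
all periods `t ≤ β` simultaneously. It matters that `N` does not depend on `L`.

The family consists of `N` arithmetic progressions of length `N`, with common differences
`L, L + δ / 3, L + 2 δ / 3, …`: one of these differences is congruent modulo `t` to a number in
`(δ / 3, 2 δ / 3]`, and that progression goes around `ℝ / t ℤ` in small steps. -/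
theorem exists_separated_net_mod {β δ : ℝ} (hβ : 0 < β) (hδ : 0 < δ) :
    ∃ N : ℕ, ∀ L : ℝ, 0 < L → ∃ s : Fin N × Fin N → ℝ,
      (∀ i j, i ≠ j → L ≤ |s i - s j|) ∧
      ∀ t, 0 < t → t ≤ β → ∀ y : ℝ, ∃ i, ∃ m : ℤ, |y + s i - m * t| < δ := by
  set N : ℕ := ⌈3 * β / δ⌉₊ + 3 with hN
  refine ⟨N, fun L hL => ?_⟩
  have hN1 : (1 : ℝ) ≤ N := by exact_mod_cast (by omega : 1 ≤ N)
  have hNβ : 3 * β / δ + 3 ≤ N := by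
    have := Nat.le_ceil (3 * β / δ)
    rw [hN]; push_cast; linarith
  set η : ℝ := δ / 3 with hη
  have hη0 : 0 < η := by positivity
  set W : ℝ := N * (L + N * η) with hW
  have hLW : L ≤ W := by
    rw [hW]; nlinarith [mul_pos (by linarith : (0 : ℝ) < N) hη0]
  have hstep : ∀ p : Fin N × Fin N, 0 ≤ (p.2 : ℝ) * (L + (p.1 : ℝ) * η) ∧
      (p.2 : ℝ) * (L + (p.1 : ℝ) * η) ≤ W := by
    intro p
    refine ⟨by positivity, ?_⟩
    have h1 : ((p.1 : ℕ) : ℝ) ≤ N := by exact_mod_cast p.1.2.le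
    have h2 : ((p.2 : ℕ) : ℝ) ≤ N := by exact_mod_cast p.2.2.le
    rw [hW]
    gcongr
  set s : Fin N × Fin N → ℝ := fun p => (p.1 : ℝ) * (2 * W) + (p.2 : ℝ) * (L + (p.1 : ℝ) * η)
    with hs
  have hrow : ∀ p q : Fin N × Fin N, p.1 < q.1 → L ≤ s q - s p := by
    intro p q h
    have h1 : ((p.1 : ℕ) : ℝ) + 1 ≤ (q.1 : ℕ) := by exact_mod_cast h
    have h2 : ((p.1 : ℝ) + 1) * (2 * W) ≤ (q.1 : ℝ) * (2 * W) := by gcongr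
    have h3 := hstep p
    have h4 := hstep q
    simp only [hs]
    linarith
  have hcol : ∀ p q : Fin N × Fin N, p.1 = q.1 → p.2 < q.2 → L ≤ s q - s p := by
    intro p q h h'
    have h1 : ((p.2 : ℕ) : ℝ) + 1 ≤ (q.2 : ℕ) := by exact_mod_cast h'
    have h2 : 0 ≤ (q.1 : ℝ) * η := by positivity
    simp only [hs, h]
    nlinarith
  have hlt : ∀ p q : Fin N × Fin N, p ≠ q → L ≤ s q - s p ∨ L ≤ s p - s q := by
    intro p q h
    rcases lt_trichotomy p.1 q.1 with h1 | h1 | h1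
    · exact Or.inl (hrow p q h1)
    · rcases lt_trichotomy p.2 q.2 with h2 | h2 | h2
      · exact Or.inl (hcol p q h1 h2)
      · exact absurd (Prod.ext h1 h2) h
      · exact Or.inr (hcol q p h1.symm h2)
    · exact Or.inr (hrow q p h1)
  refine ⟨s, fun i j hij => ?_, fun t ht htβ y => ?_⟩
  · rcases hlt i j hij with h | h
    · exact h.trans (by rw [abs_sub_comm]; exact le_abs_self _)
    · exact h.trans (le_abs_self _)
  -- The common difference `L + l η` equals `m t + e` with `e` in `(η, 2 η]`.
  set m : ℤ := ⌈L / t⌉ with hm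
  have hm1 : L ≤ m * t := (div_le_iff₀ ht).1 (Int.le_ceil _)
  have hm2 : m * t < L + t := by
    have := Int.ceil_lt_add_one (L / t)
    have h : (m : ℝ) * t < (L / t + 1) * t := by gcongr
    rwa [add_mul, div_mul_cancel₀ _ ht.ne', one_mul] at h
  set l : ℕ := ⌊(m * t + 2 * η - L) / η⌋₊ with hl
  have hl1 : l * η ≤ m * t + 2 * η - L :=
    (le_div_iff₀ hη0).1 (Nat.floor_le (by apply div_nonneg <;> linarith))
  have hl2 : m * t + 2 * η - L < (l + 1) * η := (div_lt_iff₀ hη0).1 (Nat.lt_floor_add_one _)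
  have hβη : 3 * β / δ * η = β := by rw [hη]; field_simp
  have hlN : l < N := by
    have h1 : (l : ℝ) * η < (3 * β / δ + 3) * η := by rw [add_mul, hβη]; linarith
    exact_mod_cast (lt_of_mul_lt_mul_right h1 hη0.le).trans_le hNβ
  set e : ℝ := L + l * η - m * t with he
  have he1 : η < e := by linarith
  have he2 : e < δ := by linarith
  have he0 : 0 < e := hη0.trans he1
  set y' : ℝ := y + l * (2 * W) with hy'
  set k : ℤ := ⌈y' / t⌉ with hk
  have hk1 : y' ≤ k * t := (div_le_iff₀ ht).1 (Int.le_ceil _)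
  have hk2 : k * t < y' + t := by
    have := Int.ceil_lt_add_one (y' / t)
    have h : (k : ℝ) * t < (y' / t + 1) * t := by gcongr
    rwa [add_mul, div_mul_cancel₀ _ ht.ne', one_mul] at h
  set i : ℕ := ⌊(k * t - y') / e⌋₊ with hi
  have hi1 : i * e ≤ k * t - y' :=
    (le_div_iff₀ he0).1 (Nat.floor_le (by apply div_nonneg <;> linarith))
  have hi2 : k * t - y' < (i + 1) * e := (div_lt_iff₀ he0).1 (Nat.lt_floor_add_one _)
  have hiN : i < N := by
    have h0 : (i : ℝ) * η ≤ i * e := by gcongr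
    have h1 : (i : ℝ) * η < (3 * β / δ + 3) * η := by rw [add_mul, hβη]; linarith
    exact_mod_cast (lt_of_mul_lt_mul_right h1 hη0.le).trans_le hNβ
  refine ⟨(⟨l, hlN⟩, ⟨i, hiN⟩), k + i * m, ?_⟩
  have heq : y + s (⟨l, hlN⟩, ⟨i, hiN⟩) - ((k + i * m : ℤ) : ℝ) * t = y' + i * e - k * t := by
    simp only [hs, hy', he]
    push_cast
    ring
  rw [heq, abs_lt]
  constructor <;> linarith

/-! ### Curves that shadow a given curve along a whole line -/

/-- A Gaussian factor localises a polynomial near the origin of a line in the plane. -/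
theorem exists_gaussian_decay {V : Type*} [NormedAddCommGroup V] [NormedSpace ℂ V] {ω : ℂ}
    (hω : ‖ω‖ = 1) (N : ℕ) (a : ℕ → V) {R κ : ℝ} (hκ : 0 < κ) :
    ∃ L : ℝ, 0 < L ∧ ∀ x : ℝ, L ≤ |x| → ∀ z ∈ closedBall (0 : ℂ) R,
      ‖Complex.exp (-(starRingEnd ℂ ω * (z + x * ω)) ^ 2) •
        ∑ k ∈ Finset.range N, (z + x * ω) ^ k • a k‖ ≤ κ := by
  set B : ℝ := ∑ k ∈ Finset.range N, ‖a k‖ with hB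
  have hlim : Tendsto (fun r : ℝ => Real.exp (2 * R ^ 2) * B * (r ^ N * Real.exp (-r)))
      atTop (𝓝 0) := by
    simpa using (Real.tendsto_pow_mul_exp_neg_atTop_nhds_zero N).const_mul
      (Real.exp (2 * R ^ 2) * B)
  obtain ⟨r₀, hr₀⟩ := eventually_atTop.1 (hlim.eventually_le_const hκ)
  refine ⟨max 1 r₀ + |R|, by positivity, fun x hx z hz => ?_⟩
  rw [mem_closedBall_zero_iff] at hz
  have hR : 0 ≤ R := (norm_nonneg z).trans hz
  rw [abs_of_nonneg hR] at hx
  set ζ : ℂ := z + x * ω with hζ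
  have hζr : max 1 r₀ ≤ ‖ζ‖ := by
    have h1 : ‖(x : ℂ) * ω‖ = |x| := by simp [hω]
    have h2 : ‖(x : ℂ) * ω‖ ≤ ‖ζ‖ + ‖z‖ := by
      have : (x : ℂ) * ω = ζ - z := by rw [hζ]; ring
      rw [this]; exact norm_sub_le _ _
    linarith
  have hζ1 : 1 ≤ ‖ζ‖ := (le_max_left _ _).trans hζr
  have hω2 : starRingEnd ℂ ω * ω = 1 := by
    rw [mul_comm, Complex.mul_conj, Complex.normSq_eq_norm_sq, hω]; simp
  set w : ℂ := starRingEnd ℂ ω * ζ with hw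
  have hwn : ‖w‖ = ‖ζ‖ := by rw [hw, norm_mul, RCLike.norm_conj, hω, one_mul]
  have him : |w.im| ≤ R := by
    have h1 : w = starRingEnd ℂ ω * z + x := by
      rw [hw, hζ]; linear_combination (x : ℂ) * hω2
    have h2 : w.im = (starRingEnd ℂ ω * z).im := by rw [h1]; simp
    rw [h2]
    refine (Complex.abs_im_le_norm _).trans ?_
    rwa [norm_mul, RCLike.norm_conj, hω, one_mul]
  have hre : (-w ^ 2).re ≤ 2 * R ^ 2 - ‖ζ‖ := by
    have h1 : (-w ^ 2).re = 2 * w.im ^ 2 - ‖w‖ ^ 2 := by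
      rw [← Complex.normSq_eq_norm_sq, Complex.normSq_apply, pow_two]
      simp
      ring
    have h2 : w.im ^ 2 ≤ R ^ 2 := sq_le_sq' (by linarith [neg_le_of_abs_le him])
      (le_of_abs_le him)
    rw [h1, hwn]
    nlinarith
  have hsum : ‖∑ k ∈ Finset.range N, ζ ^ k • a k‖ ≤ B * ‖ζ‖ ^ N := by
    rw [hB, Finset.sum_mul]
    refine norm_sum_le_of_le _ fun k hk => ?_
    rw [norm_smul, norm_pow, mul_comm]
    exact mul_le_mul_of_nonneg_left (pow_le_pow_right₀ hζ1 (Finset.mem_range.1 hk).le)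
      (norm_nonneg _)
  rw [norm_smul, Complex.norm_exp]
  calc Real.exp (-w ^ 2).re * ‖∑ k ∈ Finset.range N, ζ ^ k • a k‖
      ≤ Real.exp (2 * R ^ 2 - ‖ζ‖) * (B * ‖ζ‖ ^ N) := by gcongr
    _ = Real.exp (2 * R ^ 2) * B * (‖ζ‖ ^ N * Real.exp (-‖ζ‖)) := by
      rw [sub_eq_add_neg, Real.exp_add]; ring
    _ ≤ κ := hr₀ _ ((le_max_right _ _).trans hζr)

/-- An entire curve is approximated on a disc by a curve with a polynomial lift. -/
theorem EntireCurve.exists_polynomial_near {n : ℕ} (g : EntireCurve n) {K : ℝ} (hK : 0 ≤ K)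
    {ε : ℝ} (hε : 0 < ε) :
    ∃ (N : ℕ) (a : ℕ → EuclideanSpace ℂ (Fin (n + 1))) (μ : ℝ), 0 < μ ∧
      ∀ z ∈ closedBall (0 : ℂ) K, μ ≤ ‖∑ k ∈ Finset.range N, z ^ k • a k‖ ∧
        ∀ h : ∑ k ∈ Finset.range N, z ^ k • a k ≠ 0,
          dist (Projectivization.mk ℂ _ h : CP n) (g z) ≤ ε := by
  obtain ⟨G, hG⟩ := g.exists_lift_closedBall (K + 1)
  have hsub : closedBall (0 : ℂ) K ⊆ closedBall 0 (K + 1) := closedBall_subset_closedBall (by simp)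
  have hd : DifferentiableOn ℂ G (closedBall 0 (K + 1)) := fun z hz =>
    (hG z hz).1.differentiableAt.differentiableWithinAt
  obtain ⟨z₀, hz₀, hmin⟩ := (isCompact_closedBall (0 : ℂ) K).exists_isMinOn
    ⟨0, by simpa using hK⟩ (hd.continuousOn.mono hsub).norm
  obtain ⟨hne₀, -⟩ := (hG z₀ (hsub hz₀)).2.self_of_nhds
  have hμ : 0 < ‖G z₀‖ := norm_pos_iff.2 hne₀
  set μ := ‖G z₀‖
  have hκ : 0 < μ * min (1 / 2) (ε / 2) := by positivity
  obtain ⟨N, a, ha⟩ := exists_polynomial_approximation (lt_add_one K) hd hκ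
  refine ⟨N, a, μ / 2, by positivity, fun z hz => ?_⟩
  have h1 := ha z hz
  have h2 : μ ≤ ‖G z‖ := hmin hz
  have h3 : μ * min (1 / 2) (ε / 2) ≤ μ / 2 :=
    (mul_le_mul_of_nonneg_left (min_le_left _ _) hμ.le).trans_eq (by ring)
  have h4 : μ * min (1 / 2) (ε / 2) ≤ μ * (ε / 2) :=
    mul_le_mul_of_nonneg_left (min_le_right _ _) hμ.le
  rw [norm_sub_rev] at h1
  refine ⟨?_, fun h => ?_⟩
  · have := norm_sub_norm_le (G z) (∑ k ∈ Finset.range N, z ^ k • a k)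
    linarith
  · obtain ⟨hne, hgz⟩ := (hG z (hsub hz)).2.self_of_nhds
    rw [dist_comm, hgz]
    refine (dist_mk_le _ _ hne h).trans ?_
    have h5 : ‖G z - ∑ k ∈ Finset.range N, z ^ k • a k‖ / ‖G z‖ ≤ ε / 2 := by
      rw [div_le_iff₀ (hμ.trans_le h2)]
      nlinarith
    have hpi : Real.pi / 2 ≤ 2 := by linarith [Real.pi_le_four]
    calc _ ≤ 2 * (ε / 2) := by gcongr
      _ = ε := by ring

/-- For every entire curve `g` and direction `ω` there is a curve, with a decaying lift `F`, which
shadows `g` along the line of direction `ω` in the following sense: if the curve is placed at the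
point `y ω`, for any real `y`, then for each step length `t ≤ β` the translation by some multiple
`m t ω` brings it close to `g` on a disc, where `m t` is at bounded distance from `y`.

The lift is close to a sum of translates of a lift of `g` damped by a Gaussian factor. Such a factor
does not change the curve, and it makes each summand negligible near the centres of the others. -/
theorem EntireCurve.exists_shadowing_lift {n : ℕ} (hn : 1 ≤ n) (g : EntireCurve n) {ω : ℂ}
    (hω : ‖ω‖ = 1) {K β ε : ℝ} (hK : 0 ≤ K) (hβ : 0 < β) (hε : 0 < ε) :
    ∃ (F : ℂ → EuclideanSpace ℂ (Fin (n + 1))) (hF : IsDecayingLift F) (D : ℝ),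
      ∀ t, 0 < t → t ≤ β → ∀ y : ℝ, ∃ s : ℝ, |s| ≤ D ∧ ∃ m : ℤ, y + s = m * t ∧
        ∀ z ∈ closedBall (0 : ℂ) K,
          dist (Projectivization.mk ℂ (F (z + s * ω)) (hF.ne_zero _) : CP n) (g z) ≤ ε := by
  obtain ⟨N, a, μ, hμ, ha⟩ := g.exists_polynomial_near (K := K + 1) (by linarith)
    (by positivity : 0 < ε / 4)
  have huc := (isCompact_closedBall (0 : ℂ) (K + 1)).uniformContinuousOn_of_continuous
    g.continuous.continuousOn
  obtain ⟨δ', hδ', hδ'g⟩ := Metric.uniformContinuousOn_iff.1 huc (ε / 4) (by positivity)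
  set δ : ℝ := min δ' 1
  have hδ : 0 < δ := by positivity
  set p : ℂ → EuclideanSpace ℂ (Fin (n + 1)) := fun z => ∑ k ∈ Finset.range N, z ^ k • a k with hp
  set A : ℂ → EuclideanSpace ℂ (Fin (n + 1)) :=
    fun z => Complex.exp (-(starRingEnd ℂ ω * z) ^ 2) • p z with hA
  have hAd : Differentiable ℂ A := by fun_prop
  set ν : ℝ := Real.exp (-(K + 1) ^ 2) * μ with hν
  have hν0 : 0 < ν := by positivity
  have hAν : ∀ z ∈ closedBall (0 : ℂ) (K + 1), ν ≤ ‖A z‖ := by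
    intro z hz
    have h1 : ‖starRingEnd ℂ ω * z‖ ≤ K + 1 := by
      rw [norm_mul, RCLike.norm_conj, hω, one_mul]
      exact mem_closedBall_zero_iff.1 hz
    have h2 : -(K + 1) ^ 2 ≤ (-(starRingEnd ℂ ω * z) ^ 2).re := by
      rw [Complex.neg_re, neg_le_neg_iff]
      refine (Complex.re_le_norm _).trans ?_
      rw [norm_pow]
      gcongr
    simp only [hA]
    rw [norm_smul, Complex.norm_exp]
    exact mul_le_mul (Real.exp_le_exp.2 h2) (ha z hz).1 hμ.le (Real.exp_pos _).le
  obtain ⟨M, hM⟩ := exists_separated_net_mod hβ hδ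
  set κ : ℝ := ε * ν / (16 * ((M * M : ℕ) + 1)) with hκ
  have hκ0 : 0 < κ := by positivity
  obtain ⟨L, hL, hLA⟩ := exists_gaussian_decay hω N a (R := K + 1) hκ0
  obtain ⟨s, hsep, hnet⟩ := hM L hL
  set H : ℂ → EuclideanSpace ℂ (Fin (n + 1)) := fun z => ∑ i, A (z - s i * ω) with hH
  have hHd : Differentiable ℂ H := by fun_prop
  have hHA : ∀ i, ∀ z ∈ closedBall (0 : ℂ) (K + 1), ‖H (z + s i * ω) - A z‖ ≤ ε * ν / 16 := by
    intro i z hz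
    have h1 : H (z + s i * ω) - A z =
        ∑ j ∈ Finset.univ.erase i, A (z + (s i - s j : ℝ) * ω) := by
      rw [hH]
      simp only
      rw [← Finset.add_sum_erase _ _ (Finset.mem_univ i), add_sub_cancel_right, add_sub_cancel_left]
      refine Finset.sum_congr rfl fun j _ => ?_
      congr 1
      push_cast
      ring
    rw [h1]
    refine (norm_sum_le_of_le _ (f := fun j => A (z + (s i - s j : ℝ) * ω)) (n := fun _ => κ)
      fun j hj => hLA _ (hsep i j (Finset.ne_of_mem_erase hj).symm) z hz).trans ?_
    rw [Finset.sum_const, nsmul_eq_mul]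
    have hcard : (((Finset.univ.erase i).card : ℕ) : ℝ) ≤ ((M * M : ℕ) : ℝ) + 1 := by
      have : (Finset.univ.erase i).card ≤ M * M := by
        refine (Finset.card_erase_le).trans_eq ?_
        simp
      exact (Nat.cast_le.2 this).trans (by linarith)
    calc _ ≤ (((M * M : ℕ) : ℝ) + 1) * κ := by gcongr
      _ = ε * ν / 16 := by rw [hκ]; field_simp
  set D : ℝ := ∑ i, |s i| with hD
  have hsD : ∀ i, |s i| ≤ D := fun i =>
    Finset.single_le_sum (f := fun i => |s i|) (fun _ _ => abs_nonneg _) (Finset.mem_univ i)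
  obtain ⟨F, hF, hFH⟩ := exists_isDecayingLift_near hn hHd (K + 1 + D)
    (by positivity : 0 < ε * ν / 16)
  refine ⟨F, hF, D + δ, fun t ht htβ y => ?_⟩
  obtain ⟨i, m, him⟩ := hnet t ht htβ y
  set r : ℝ := m * t - y - s i with hr
  have hrδ : |r| < δ := by rw [← abs_neg]; convert him using 2; rw [hr]; ring
  refine ⟨s i + r, (abs_add_le _ _).trans (add_le_add (hsD i) hrδ.le), m, by rw [hr]; ring,
    fun z hz => ?_⟩
  have hrω : ‖(r : ℂ) * ω‖ < δ := by simpa [hω] using hrδ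
  set z' : ℂ := z + r * ω with hz'
  have hz'K : z' ∈ closedBall (0 : ℂ) (K + 1) := by
    rw [mem_closedBall_zero_iff] at hz ⊢
    have := norm_add_le z (r * ω)
    have := min_le_right δ' 1
    linarith
  have hpne : p z' ≠ 0 := norm_pos_iff.1 (hμ.trans_le (ha z' hz'K).1)
  have hAne : A z' ≠ 0 := norm_pos_iff.1 (hν0.trans_le (hAν z' hz'K))
  have h1 : dist (Projectivization.mk ℂ (A z') hAne : CP n)
      (Projectivization.mk ℂ (F (z + (s i + r : ℝ) * ω)) (hF.ne_zero _)) ≤ ε / 4 := by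
    refine (dist_mk_le _ _ _ _).trans ?_
    have heq : z + (s i + r : ℝ) * ω = z' + s i * ω := by rw [hz']; push_cast; ring
    have hball : z' + s i * ω ∈ closedBall (0 : ℂ) (K + 1 + D) := by
      rw [mem_closedBall_zero_iff] at hz'K ⊢
      have h2 : ‖(s i : ℂ) * ω‖ ≤ D := by simpa [hω] using hsD i
      exact (norm_add_le _ _).trans (add_le_add hz'K h2)
    have h2 : ‖A z' - F (z + (s i + r : ℝ) * ω)‖ ≤ ε * ν / 8 := by
      rw [heq, norm_sub_rev]
      calc _ ≤ ‖F (z' + s i * ω) - H (z' + s i * ω)‖ + ‖H (z' + s i * ω) - A z'‖ :=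
            norm_sub_le_norm_sub_add_norm_sub _ _ _
        _ ≤ ε * ν / 16 + ε * ν / 16 := add_le_add (hFH _ hball) (hHA i z' hz'K)
        _ = _ := by ring
    have h3 : ‖A z' - F (z + (s i + r : ℝ) * ω)‖ / ‖A z'‖ ≤ ε / 8 := by
      have h4 := hAν z' hz'K
      rw [div_le_iff₀ (hν0.trans_le h4)]
      nlinarith
    have hpi : Real.pi / 2 ≤ 2 := by linarith [Real.pi_le_four]
    calc _ ≤ 2 * (ε / 8) := by gcongr
      _ = ε / 4 := by ring
  have h2 : dist (Projectivization.mk ℂ (A z') hAne : CP n) (g z') ≤ ε / 4 := by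
    have : (Projectivization.mk ℂ (A z') hAne : CP n) = Projectivization.mk ℂ (p z') hpne :=
      mk_smul_eq hpne hAne
    rw [this]
    exact (ha z' hz'K).2 hpne
  have h3 : dist (g z') (g z) ≤ ε / 4 := by
    refine (hδ'g z' hz'K z ?_ ?_).le
    · exact closedBall_subset_closedBall (by linarith) hz
    · rw [dist_eq_norm, hz', add_sub_cancel_left]
      exact hrω.trans_le (min_le_left _ _)
  rw [dist_comm] at h1
  have h4 := dist_triangle4 (Projectivization.mk ℂ (F (z + (s i + r : ℝ) * ω)) (hF.ne_zero _) :
    CP n) (Projectivization.mk ℂ (A z') hAne) (g z') (g z)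
  linarith

/-! ### Superposition of sparsely placed curves -/

/-- A sequence of decaying lifts, to be translated to the given centres, together with disjoint
discs around the centres outside of which the curves are close to the base point `[1 : 0 : … : 0]`.
The discs leave every bounded set. -/
structure SparseFamily (n : ℕ) where
  lift : ℕ → ℂ → EuclideanSpace ℂ (Fin (n + 1))
  centre : ℕ → ℂ
  radius : ℕ → ℝ
  isDecayingLift : ∀ i, IsDecayingLift (lift i)
  ne_zero : ∀ i ζ, radius i ≤ ‖ζ‖ → lift i ζ 0 ≠ 0
  norm_affinePart_le : ∀ i ζ, radius i ≤ ‖ζ‖ → ‖affinePart (lift i) ζ‖ ≤ (1 / 2) ^ i / 8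
  norm_deriv_le : ∀ i ζ, radius i ≤ ‖ζ‖ → ‖deriv (affinePart (lift i)) ζ‖ ≤ (1 / 2) ^ i / 8
  disjoint : ∀ i j z, i ≠ j → ‖z - centre j‖ ≤ radius j → radius i < ‖z - centre i‖
  le_norm_centre : ∀ i, i + radius i ≤ ‖centre i‖

theorem fsNormSq_le {V : Type*} [NormedAddCommGroup V]
    [InnerProductSpace ℂ V] {v : V} (hv : v ≠ 0) (ξ : V) :
    fsNormSq v ξ ≤ (‖ξ‖ / ‖v‖) ^ 2 := by
  have hv' : 0 < ‖v‖ := norm_pos_iff.2 hv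
  rw [fsNormSq, div_pow, div_le_div_iff₀ (by positivity) (by positivity)]
  nlinarith [mul_nonneg (sq_nonneg ‖⟪v, ξ⟫_ℂ‖) (sq_nonneg ‖v‖)]

theorem summable_geometric_div : Summable fun i : ℕ => (1 / 2 : ℝ) ^ i / 8 :=
  summable_geometric_two.div_const 8

theorem tsum_geometric_div : ∑' i : ℕ, (1 / 2 : ℝ) ^ i / 8 = 1 / 4 := by
  rw [tsum_div_const, tsum_geometric_two]
  norm_num

namespace SparseFamily

variable {n : ℕ} (S : SparseFamily n)

/-- The affine displacement of the `i`-th translated curve from the base point. -/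
noncomputable def displacement (i : ℕ) (z : ℂ) : EuclideanSpace ℂ (Fin (n + 1)) :=
  affinePart (S.lift i) (z - S.centre i)

/-- The points outside all discs of the family except possibly the `j`-th. -/
def awayFrom (j : ℕ) : Set ℂ := {z | ∀ i, i ≠ j → S.radius i < ‖z - S.centre i‖}

/-- The points outside all discs of the family. -/
def free : Set ℂ := {z | ∀ i, S.radius i < ‖z - S.centre i‖}

theorem locallyFinite : LocallyFinite fun i => closedBall (S.centre i) (S.radius i) := by
  intro x
  refine ⟨ball x 1, ball_mem_nhds x one_pos, (finite_le_nat ⌈‖x‖ + 1⌉₊).subset ?_⟩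
  rintro i ⟨y, hy1, hy2⟩
  rw [mem_closedBall, dist_eq_norm] at hy1
  rw [mem_ball, dist_eq_norm] at hy2
  have h1 := S.le_norm_centre i
  have h2 : ‖S.centre i‖ ≤ ‖y‖ + ‖y - S.centre i‖ := by
    have : S.centre i = y - (y - S.centre i) := by ring
    conv_lhs => rw [this]
    exact norm_sub_le _ _
  have h3 := norm_sub_norm_le y x
  have h4 : (i : ℝ) ≤ ‖x‖ + 1 := by linarith
  exact_mod_cast h4.trans (Nat.le_ceil _)

theorem isOpen_awayFrom (j : ℕ) : IsOpen (S.awayFrom j) := by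
  have h := (S.locallyFinite.comp_injective (g := fun i : {i // i ≠ j} => (i : ℕ))
    Subtype.val_injective).isClosed_iUnion fun i => isClosed_closedBall
  convert h.isOpen_compl using 1
  ext z
  simp [awayFrom, dist_eq_norm]

theorem isOpen_free : IsOpen S.free := by
  convert (S.locallyFinite.isClosed_iUnion fun i => isClosed_closedBall).isOpen_compl using 1
  ext z
  simp [free, dist_eq_norm]

theorem free_subset_awayFrom (j : ℕ) : S.free ⊆ S.awayFrom j := fun _ hz i _ => hz i

theorem differentiableAt_displacement {i : ℕ} {z : ℂ} (hz : S.radius i ≤ ‖z - S.centre i‖) :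
    DifferentiableAt ℂ (S.displacement i) z :=
  DifferentiableAt.comp z (differentiableAt_affinePart ((S.isDecayingLift i).differentiable _)
    (S.ne_zero i _ hz)) (differentiableAt_id.sub_const _)

theorem norm_displacement_le {i : ℕ} {z : ℂ} (hz : S.radius i ≤ ‖z - S.centre i‖) :
    ‖S.displacement i z‖ ≤ (1 / 2) ^ i / 8 := S.norm_affinePart_le i _ hz

theorem deriv_displacement (i : ℕ) (z : ℂ) :
    deriv (S.displacement i) z = deriv (affinePart (S.lift i)) (z - S.centre i) :=
  deriv_comp_sub_const (f := affinePart (S.lift i)) _ _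

/-- The displacements of all curves but the `j`-th, set to zero for the `j`-th. -/
noncomputable def others (j i : ℕ) (z : ℂ) : EuclideanSpace ℂ (Fin (n + 1)) :=
  if i = j then 0 else S.displacement i z

/-- The total displacement caused by all curves but the `j`-th. -/
noncomputable def tail (j : ℕ) (z : ℂ) : EuclideanSpace ℂ (Fin (n + 1)) := ∑' i, S.others j i z

theorem norm_others_le {j : ℕ} (i : ℕ) {z : ℂ} (hz : z ∈ S.awayFrom j) :
    ‖S.others j i z‖ ≤ (1 / 2) ^ i / 8 := by
  unfold others
  split_ifs with h
  · rw [norm_zero]; positivity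
  · exact S.norm_displacement_le (hz i h).le

theorem differentiableOn_others (j i : ℕ) : DifferentiableOn ℂ (S.others j i) (S.awayFrom j) := by
  intro z hz
  by_cases h : i = j
  · have : S.others j i = fun _ => 0 := by funext w; simp [others, h]
    rw [this]
    exact differentiableWithinAt_const _
  · have : S.others j i = S.displacement i := by funext w; simp [others, h]
    rw [this]
    exact (S.differentiableAt_displacement (hz i h).le).differentiableWithinAt

theorem differentiableOn_tail (j : ℕ) : DifferentiableOn ℂ (S.tail j) (S.awayFrom j) :=
  Complex.differentiableOn_tsum_of_summable_norm summable_geometric_div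
    (S.differentiableOn_others j) (S.isOpen_awayFrom j) fun i _ hz => S.norm_others_le i hz

theorem norm_tail_le {j : ℕ} {z : ℂ} (hz : z ∈ S.awayFrom j) : ‖S.tail j z‖ ≤ 1 / 4 := by
  rw [← tsum_geometric_div]
  exact tsum_of_norm_bounded summable_geometric_div.hasSum fun i => S.norm_others_le i hz

theorem norm_deriv_tail_le {j : ℕ} {z : ℂ} (hz : z ∈ S.awayFrom j) :
    ‖deriv (S.tail j) z‖ ≤ 1 / 4 := by
  have h := Complex.hasSum_deriv_of_summable_norm summable_geometric_div
    (S.differentiableOn_others j) (S.isOpen_awayFrom j) (fun i _ hz => S.norm_others_le i hz) hz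
  have h' : deriv (S.tail j) z = ∑' i, deriv (S.others j i) z := h.tsum_eq.symm
  rw [h', ← tsum_geometric_div]
  refine tsum_of_norm_bounded summable_geometric_div.hasSum fun i => ?_
  by_cases hij : i = j
  · have : S.others j i = fun _ => 0 := by funext w; simp [others, hij]
    rw [this, deriv_const, norm_zero]
    positivity
  · have : S.others j i = S.displacement i := by funext w; simp [others, hij]
    rw [this, deriv_displacement]
    exact S.norm_deriv_le i _ (hz i hij).le

/-- A lift of the superposition away from all discs but the `j`-th: the `j`-th curve, moved by the
translation `[Z₀ : Z'] ↦ [Z₀ : Z' + Z₀ v]` of the affine chart, where `v` is the displacement caused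
by the other curves. It makes sense at the poles of the `j`-th displacement. -/
noncomputable def localLift (j : ℕ) (z : ℂ) : EuclideanSpace ℂ (Fin (n + 1)) :=
  S.lift j (z - S.centre j) + S.lift j (z - S.centre j) 0 • S.tail j z

theorem norm_localLift_ge {j : ℕ} {z : ℂ} (hz : z ∈ S.awayFrom j) :
    3 / 4 * ‖S.lift j (z - S.centre j)‖ ≤ ‖S.localLift j z‖ := by
  have h1 : ‖S.lift j (z - S.centre j) 0 • S.tail j z‖ ≤ ‖S.lift j (z - S.centre j)‖ * (1 / 4) := by
    rw [norm_smul]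
    exact mul_le_mul (PiLp.norm_apply_le _ _) (S.norm_tail_le hz) (norm_nonneg _) (norm_nonneg _)
  have h2 := norm_sub_le_norm_add (S.lift j (z - S.centre j))
    (S.lift j (z - S.centre j) 0 • S.tail j z)
  unfold localLift
  linarith

theorem norm_lift_pos (j : ℕ) (ζ : ℂ) : 0 < ‖S.lift j ζ‖ :=
  norm_pos_iff.2 ((S.isDecayingLift j).ne_zero ζ)

theorem localLift_ne_zero {j : ℕ} {z : ℂ} (hz : z ∈ S.awayFrom j) : S.localLift j z ≠ 0 := by
  have h1 := S.norm_localLift_ge hz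
  have h2 := S.norm_lift_pos j (z - S.centre j)
  exact norm_pos_iff.1 (by linarith)

theorem differentiableOn_localLift (j : ℕ) :
    DifferentiableOn ℂ (S.localLift j) (S.awayFrom j) := by
  have h1 : Differentiable ℂ fun z => S.lift j (z - S.centre j) :=
    (S.isDecayingLift j).differentiable.comp (differentiable_id.sub_const _)
  have h2 : Differentiable ℂ fun z => S.lift j (z - S.centre j) 0 := fun z =>
    differentiableAt_euclidean.1 (h1 z) 0
  exact h1.differentiableOn.add (h2.differentiableOn.smul (S.differentiableOn_tail j))

/-- The lift of the superposition in the affine chart, outside all discs. -/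
noncomputable def freeLift (z : ℂ) : EuclideanSpace ℂ (Fin (n + 1)) :=
  baseVec n + ∑' i, S.displacement i z

theorem localLift_eq_smul (j : ℕ) {z : ℂ} (hz : z ∈ S.free) :
    S.localLift j z = S.lift j (z - S.centre j) 0 • S.freeLift z := by
  have hsum : Summable fun i => S.displacement i z :=
    .of_norm_bounded summable_geometric_div fun i => S.norm_displacement_le (hz i).le
  have h1 := hsum.tsum_eq_add_tsum_ite j
  have h2 : S.tail j z = ∑' i, if i = j then 0 else S.displacement i z := rfl
  rw [freeLift, h1, ← h2, ← add_assoc, smul_add, displacement,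
    smul_baseVec_add_affinePart (S.ne_zero j _ (hz j).le), localLift]

open Classical in
/-- The index of the disc that contains `z`; outside the discs its value does not matter. -/
noncomputable def activeIndex (z : ℂ) : ℕ :=
  if h : ∃ j, ‖z - S.centre j‖ ≤ S.radius j then h.choose else 0

theorem mem_free_or (z : ℂ) : z ∈ S.free ∨ ‖z - S.centre (S.activeIndex z)‖ ≤
    S.radius (S.activeIndex z) := by
  by_cases h : ∃ j, ‖z - S.centre j‖ ≤ S.radius j
  · right
    rw [activeIndex, dif_pos h]
    exact h.choose_spec
  · left
    intro i
    by_contra hi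
    exact h ⟨i, not_lt.1 hi⟩

theorem mem_awayFrom_of_norm_le {j : ℕ} {z : ℂ} (hz : ‖z - S.centre j‖ ≤ S.radius j) :
    z ∈ S.awayFrom j := fun i hi => S.disjoint i j z hi hz

theorem mem_awayFrom_activeIndex (z : ℂ) : z ∈ S.awayFrom (S.activeIndex z) := by
  rcases S.mem_free_or z with h | h
  · exact S.free_subset_awayFrom _ h
  · exact S.mem_awayFrom_of_norm_le h

/-- The superposition as a map to projective space. -/
noncomputable def toMap (z : ℂ) : CP n :=
  Projectivization.mk ℂ (S.localLift (S.activeIndex z) z)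
    (S.localLift_ne_zero (S.mem_awayFrom_activeIndex z))

theorem freeLift_ne_zero {z : ℂ} (hz : z ∈ S.free) : S.freeLift z ≠ 0 := by
  intro h
  have h1 := S.localLift_eq_smul 0 hz
  rw [h, smul_zero] at h1
  exact S.localLift_ne_zero (S.free_subset_awayFrom 0 hz) h1

theorem mk_localLift_eq_mk_freeLift (j : ℕ) {z : ℂ} (hz : z ∈ S.free) :
    (Projectivization.mk ℂ (S.localLift j z)
      (S.localLift_ne_zero (S.free_subset_awayFrom j hz)) : CP n) =
      Projectivization.mk ℂ (S.freeLift z) (S.freeLift_ne_zero hz) :=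
  (Projectivization.mk_eq_mk_iff' ℂ _ _ _ _).2 ⟨_, (S.localLift_eq_smul j hz).symm⟩

theorem toMap_eq_localLift {j : ℕ} {z : ℂ} (hz : z ∈ S.awayFrom j) :
    S.toMap z = Projectivization.mk ℂ (S.localLift j z) (S.localLift_ne_zero hz) := by
  rcases S.mem_free_or z with h | h
  · rw [toMap, S.mk_localLift_eq_mk_freeLift _ h, S.mk_localLift_eq_mk_freeLift _ h]
  · have hj : S.activeIndex z = j := by
      by_contra hne
      exact absurd (hz _ hne) (not_lt.2 h)
    subst hj
    rfl

theorem isLocalLift_localLift {j : ℕ} {z : ℂ} (hz : z ∈ S.awayFrom j) :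
    IsLocalLift (S.localLift j) S.toMap z := by
  have hnhds := (S.isOpen_awayFrom j).mem_nhds hz
  refine ⟨(S.differentiableOn_localLift j).analyticAt hnhds, ?_⟩
  filter_upwards [hnhds] with w hw
  exact ⟨S.localLift_ne_zero hw, S.toMap_eq_localLift hw⟩

/-- The superposition of the curves of a sparse family: in the affine chart `Z₀ ≠ 0` it is the sum
of the translated curves. -/
noncomputable def curve : EntireCurve n where
  toFun := S.toMap
  holomorphic' z := ⟨_, S.isLocalLift_localLift (S.mem_awayFrom_activeIndex z)⟩

theorem dist_curve_le {j : ℕ} {z : ℂ} (hz : z ∈ S.awayFrom j) :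
    dist (Projectivization.mk ℂ (S.lift j (z - S.centre j))
      ((S.isDecayingLift j).ne_zero _) : CP n) (S.curve z) ≤ 2 * ‖S.tail j z‖ := by
  have h1 : S.curve z = Projectivization.mk ℂ (S.localLift j z) (S.localLift_ne_zero hz) :=
    S.toMap_eq_localLift hz
  rw [h1]
  refine (dist_mk_le _ _ _ _).trans ?_
  have h2 : ‖S.lift j (z - S.centre j) - S.localLift j z‖ / ‖S.lift j (z - S.centre j)‖ ≤
      ‖S.tail j z‖ := by
    rw [div_le_iff₀ (S.norm_lift_pos j _), localLift, sub_add_cancel_left, norm_neg, norm_smul,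
      mul_comm]
    gcongr
    exact PiLp.norm_apply_le _ _
  have hpi : Real.pi / 2 ≤ 2 := by linarith [Real.pi_le_four]
  gcongr

theorem norm_tail_le_of_forall {j : ℕ} {z : ℂ} {τ : ℝ}
    (h : ∀ i, i ≠ j → ‖S.displacement i z‖ ≤ (1 / 2) ^ i / 8 * τ) (hτ : 0 ≤ τ) :
    ‖S.tail j z‖ ≤ τ := by
  have hs := summable_geometric_div.mul_right τ
  have h1 : ‖S.tail j z‖ ≤ ∑' i : ℕ, (1 / 2 : ℝ) ^ i / 8 * τ := by
    refine tsum_of_norm_bounded hs.hasSum fun i => ?_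
    unfold others
    split_ifs with hij
    · rw [norm_zero]; positivity
    · exact h i hij
  rw [tsum_mul_right, tsum_geometric_div] at h1
  linarith

/-! ### The area of a superposition -/

theorem fsDensity_curve_le {z : ℂ} {F : ℂ → EuclideanSpace ℂ (Fin (n + 1))}
    (hF : IsLocalLift F S.curve z) {c : ℝ} (hc : ‖deriv F z‖ ≤ c * ‖F z‖) :
    fsDensity S.curve z ≤ c ^ 2 / Real.pi := by
  obtain ⟨h0, -⟩ := hF.2.self_of_nhds
  have h0' : 0 < ‖F z‖ := norm_pos_iff.2 h0
  rw [fsDensity_eq hF, mul_comm, ← div_eq_mul_inv]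
  have hpi := Real.pi_pos
  gcongr
  refine (fsNormSq_le h0 _).trans ?_
  gcongr
  rwa [div_le_iff₀ h0']

theorem fsDensity_le_of_mem_disc {j : ℕ} {z : ℂ} (hz : ‖z - S.centre j‖ ≤ S.radius j) :
    fsDensity S.curve z ≤
      (2 * (1 + ‖deriv (S.lift j) (z - S.centre j)‖ / ‖S.lift j (z - S.centre j)‖)) ^ 2
        / Real.pi := by
  have hza := S.mem_awayFrom_of_norm_le hz
  refine S.fsDensity_curve_le (S.isLocalLift_localLift hza) ?_
  set ζ := z - S.centre j with hζ
  have hpos := S.norm_lift_pos j ζ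
  have hF : HasDerivAt (fun w => S.lift j (w - S.centre j)) (deriv (S.lift j) ζ) z :=
    ((S.isDecayingLift j).differentiable ζ).hasDerivAt.comp_sub_const z _
  have hF0 : HasDerivAt (fun w => S.lift j (w - S.centre j) 0) (deriv (S.lift j) ζ 0) z := by
    exact (EuclideanSpace.proj (𝕜 := ℂ) 0 : _ →L[ℂ] ℂ).hasFDerivAt.comp_hasDerivAt z hF
  have hT : HasDerivAt (S.tail j) (deriv (S.tail j) z) z :=
    ((S.differentiableOn_tail j).differentiableAt
      ((S.isOpen_awayFrom j).mem_nhds hza)).hasDerivAt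
  have hL : HasDerivAt (S.localLift j) _ z := hF.add (hF0.smul hT)
  rw [hL.deriv]
  have hge := S.norm_localLift_ge hza
  rw [← hζ] at hge
  have h1 : ‖S.lift j ζ 0 • deriv (S.tail j) z‖ ≤ ‖S.lift j ζ‖ * (1 / 4) := by
    rw [norm_smul]
    exact mul_le_mul (PiLp.norm_apply_le _ _) (S.norm_deriv_tail_le hza) (norm_nonneg _)
      (norm_nonneg _)
  have h2 : ‖deriv (S.lift j) ζ 0 • S.tail j z‖ ≤ ‖deriv (S.lift j) ζ‖ * (1 / 4) := by
    rw [norm_smul]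
    exact mul_le_mul (PiLp.norm_apply_le _ _) (S.norm_tail_le hza) (norm_nonneg _) (norm_nonneg _)
  calc _ ≤ ‖deriv (S.lift j) ζ‖ + (‖S.lift j ζ‖ * (1 / 4) + ‖deriv (S.lift j) ζ‖ * (1 / 4)) :=
        (norm_add_le _ _).trans
          (add_le_add_right ((norm_add_le _ _).trans (add_le_add h1 h2)) _)
    _ ≤ 2 * (1 + ‖deriv (S.lift j) ζ‖ / ‖S.lift j ζ‖) * (3 / 4 * ‖S.lift j ζ‖) := by
        have : ‖deriv (S.lift j) ζ‖ / ‖S.lift j ζ‖ * ‖S.lift j ζ‖ = ‖deriv (S.lift j) ζ‖ :=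
          div_mul_cancel₀ _ hpos.ne'
        nlinarith [norm_nonneg (deriv (S.lift j) ζ)]
    _ ≤ _ := by gcongr

theorem norm_freeLift_ge {z : ℂ} (hz : z ∈ S.free) : 3 / 4 ≤ ‖S.freeLift z‖ := by
  have h1 : ‖∑' i, S.displacement i z‖ ≤ 1 / 4 := by
    rw [← tsum_geometric_div]
    exact tsum_of_norm_bounded summable_geometric_div.hasSum fun i =>
      S.norm_displacement_le (hz i).le
  have h2 := norm_sub_le_norm_add (baseVec n) (∑' i, S.displacement i z)
  rw [norm_baseVec] at h2
  unfold freeLift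
  linarith

theorem fsDensity_le_of_mem_free {z : ℂ} (hz : z ∈ S.free) :
    fsDensity S.curve z ≤ (∑' i, ‖deriv (S.displacement i) z‖) ^ 2 := by
  have hnhds := S.isOpen_free.mem_nhds hz
  have hdiff : ∀ i, DifferentiableOn ℂ (S.displacement i) S.free := fun i w hw =>
    (S.differentiableAt_displacement (hw i).le).differentiableWithinAt
  have hle : ∀ i w, w ∈ S.free → ‖S.displacement i w‖ ≤ (1 / 2) ^ i / 8 := fun i w hw =>
    S.norm_displacement_le (hw i).le
  have hsumd : DifferentiableOn ℂ (fun w => ∑' i, S.displacement i w) S.free :=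
    Complex.differentiableOn_tsum_of_summable_norm summable_geometric_div hdiff S.isOpen_free hle
  have hlift : IsLocalLift S.freeLift S.curve z := by
    refine ⟨((differentiableOn_const (baseVec n)).add hsumd).analyticAt hnhds, ?_⟩
    filter_upwards [hnhds] with w hw
    exact ⟨S.freeLift_ne_zero hw, (S.toMap_eq_localLift (S.free_subset_awayFrom 0 hw)).trans
      (S.mk_localLift_eq_mk_freeLift 0 hw)⟩
  have hderiv : deriv S.freeLift z = ∑' i, deriv (S.displacement i) z := by
    have h := Complex.hasSum_deriv_of_summable_norm summable_geometric_div hdiff S.isOpen_free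
      hle hz
    rw [h.tsum_eq]
    exact deriv_const_add _
  have hsum : Summable fun i => ‖deriv (S.displacement i) z‖ := by
    refine .of_nonneg_of_le (fun _ => norm_nonneg _) (fun i => ?_) summable_geometric_div
    rw [deriv_displacement]
    exact S.norm_deriv_le i _ (hz i).le
  have hA : 0 ≤ ∑' i, ‖deriv (S.displacement i) z‖ := tsum_nonneg fun _ => norm_nonneg _
  have h1 : ‖deriv S.freeLift z‖ ≤
      (4 / 3 * ∑' i, ‖deriv (S.displacement i) z‖) * ‖S.freeLift z‖ := by
    rw [hderiv]
    have := S.norm_freeLift_ge hz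
    refine (norm_tsum_le_tsum_norm hsum).trans ?_
    nlinarith
  refine (S.fsDensity_curve_le hlift h1).trans ?_
  rw [div_le_iff₀ Real.pi_pos, mul_pow]
  nlinarith [Real.pi_gt_three, sq_nonneg (∑' i, ‖deriv (S.displacement i) z‖)]

end SparseFamily

/-- A weighted Cauchy–Schwarz inequality. -/
theorem sq_tsum_le_tsum {a q : ℕ → ℝ} (ha : ∀ i, 0 ≤ a i) (hq : Summable q)
    (h : ∀ i, 4 ^ (i + 1) * a i ^ 2 ≤ q i) : (∑' i, a i) ^ 2 ≤ ∑' i, q i := by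
  have hq0 : ∀ i, 0 ≤ q i := fun i => le_trans (by positivity) (h i)
  have hQ : 0 ≤ ∑' i, q i := tsum_nonneg hq0
  have hle : ∀ i, a i ≤ √(∑' i, q i) / 2 / 2 ^ i := by
    intro i
    have h1 : 2 ^ (i + 1) * a i ≤ √(∑' i, q i) := by
      refine Real.le_sqrt_of_sq_le (le_trans (le_of_eq ?_)
        ((h i).trans (hq.le_tsum i fun j _ => hq0 j)))
      rw [mul_pow, ← pow_mul, mul_comm (i + 1), pow_mul]
      norm_num
    rw [div_div, le_div_iff₀ (by positivity), ← pow_succ', mul_comm]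
    exact h1
  have hs : Summable a := .of_nonneg_of_le ha hle (summable_geometric_two' _)
  have h1 : ∑' i, a i ≤ √(∑' i, q i) :=
    (hs.tsum_le_tsum hle (summable_geometric_two' _)).trans_eq (tsum_geometric_two' _)
  calc (∑' i, a i) ^ 2 ≤ √(∑' i, q i) ^ 2 := by
        gcongr
        exact tsum_nonneg ha
    _ = _ := Real.sq_sqrt hQ

theorem lintegral_inv_one_add_norm_cube_lt_top :
    ∫⁻ z : ℂ, ENNReal.ofReal (((1 + ‖z‖) ^ 3)⁻¹) < ⊤ := by
  have h := finite_integral_one_add_norm (μ := (volume : Measure ℂ)) (r := 3) (by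
    rw [Complex.finrank_real_complex]; norm_num)
  refine lt_of_le_of_lt (lintegral_mono fun z => le_of_eq ?_) h
  have : (0 : ℝ) ≤ 1 + ‖z‖ := by positivity
  rw [Real.rpow_neg this]
  norm_cast

/-- A sum over the indices `i` with `d i < r` is bounded by partial sums, because any finite set of
such indices lies in an initial segment which ends in one of them. -/
theorem tsum_ite_ofReal_le {b d : ℕ → ℝ} (hb : ∀ i, 0 ≤ b i) {r M : ℝ}
    (h : ∀ k, d k < r → ∑ i ∈ Finset.range (k + 1), b i ≤ M) :
    ∑' i, (if d i < r then ENNReal.ofReal (b i) else 0) ≤ ENNReal.ofReal M := by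
  rw [ENNReal.tsum_eq_iSup_sum]
  refine iSup_le fun s => ?_
  rw [← Finset.sum_filter]
  rcases (s.filter fun i => d i < r).eq_empty_or_nonempty with he | hne
  · simp [he]
  · obtain ⟨k, hk, hmax⟩ := Finset.exists_max_image _ (fun i => i) hne
    rw [← ENNReal.ofReal_sum_of_nonneg fun i _ => hb i]
    refine ENNReal.ofReal_le_ofReal (le_trans ?_ (h k (Finset.mem_filter.1 hk).2))
    exact Finset.sum_le_sum_of_subset_of_nonneg
      (fun i hi => Finset.mem_range.2 (Nat.lt_succ_of_le (hmax i hi))) fun i _ _ => hb i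

namespace SparseFamily

variable {n : ℕ} (S : SparseFamily n)

/-- On the `i`-th disc the density is at most `B i`; outside the discs it is bounded through the
derivatives of the displacements, whose squares are integrable at infinity. -/
theorem ofReal_fsDensity_le {B : ℕ → ℝ} {τ : ℝ}
    (hB : ∀ i ζ, ‖ζ‖ ≤ S.radius i →
      (2 * (1 + ‖deriv (S.lift i) ζ‖ / ‖S.lift i ζ‖)) ^ 2 / Real.pi ≤ B i)
    (hd : ∀ i ζ, S.radius i ≤ ‖ζ‖ → 4 ^ (i + 1) * ‖deriv (affinePart (S.lift i)) ζ‖ ^ 2 ≤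
      τ / 2 / 2 ^ i * ((1 + ‖ζ‖) ^ 3)⁻¹) (hτ : 0 ≤ τ) (z : ℂ) :
    ENNReal.ofReal (fsDensity S.curve z) ≤
      (∑' i, (closedBall (S.centre i) (S.radius i)).indicator (fun _ => ENNReal.ofReal (B i)) z) +
      ∑' i, ENNReal.ofReal (τ / 2 / 2 ^ i) *
        ENNReal.ofReal (((1 + ‖z - S.centre i‖) ^ 3)⁻¹) := by
  rcases S.mem_free_or z with h | h
  · refine le_trans ?_ le_add_self
    set q : ℕ → ℝ := fun i => τ / 2 / 2 ^ i * ((1 + ‖z - S.centre i‖) ^ 3)⁻¹ with hq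
    have hq0 : ∀ i, 0 ≤ q i := fun i => by positivity
    have hqs : Summable q := by
      refine .of_nonneg_of_le hq0 (fun i => ?_) (summable_geometric_two' τ)
      refine mul_le_of_le_one_right (by positivity) (inv_le_one_of_one_le₀ ?_)
      exact one_le_pow₀ (by linarith [norm_nonneg (z - S.centre i)])
    have h1 : fsDensity S.curve z ≤ ∑' i, q i := by
      refine (S.fsDensity_le_of_mem_free h).trans
        (sq_tsum_le_tsum (fun _ => norm_nonneg _) hqs fun i => ?_)
      rw [deriv_displacement]
      exact hd i _ (h i).le
    refine (ENNReal.ofReal_le_ofReal h1).trans_eq ?_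
    rw [ENNReal.ofReal_tsum_of_nonneg hq0 hqs]
    exact tsum_congr fun i => ENNReal.ofReal_mul (by positivity)
  · refine le_trans ?_ le_self_add
    refine le_trans ?_ (ENNReal.le_tsum (S.activeIndex z))
    rw [indicator_of_mem (by rwa [mem_closedBall, dist_eq_norm])]
    exact ENNReal.ofReal_le_ofReal ((S.fsDensity_le_of_mem_disc h).trans (hB _ _ h))

/-- The area of the superposition over a disc is bounded by the contributions of those discs of the
family that are met, up to a remainder which does not depend on the disc. -/
theorem lintegral_fsDensity_le {B : ℕ → ℝ} {τ : ℝ}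
    (hB : ∀ i ζ, ‖ζ‖ ≤ S.radius i →
      (2 * (1 + ‖deriv (S.lift i) ζ‖ / ‖S.lift i ζ‖)) ^ 2 / Real.pi ≤ B i)
    (hd : ∀ i ζ, S.radius i ≤ ‖ζ‖ → 4 ^ (i + 1) * ‖deriv (affinePart (S.lift i)) ζ‖ ^ 2 ≤
      τ / 2 / 2 ^ i * ((1 + ‖ζ‖) ^ 3)⁻¹) (hτ : 0 ≤ τ) (r : ℝ) :
    ∫⁻ z in ball (0 : ℂ) r, ENNReal.ofReal (fsDensity S.curve z) ≤
      (∑' i, if ‖S.centre i‖ - S.radius i < r then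
        ENNReal.ofReal (B i * (Real.pi * S.radius i ^ 2)) else 0) +
      ENNReal.ofReal τ * ∫⁻ z : ℂ, ENNReal.ofReal (((1 + ‖z‖) ^ 3)⁻¹) := by
  refine (lintegral_mono fun z => S.ofReal_fsDensity_le hB hd hτ z).trans ?_
  have hm : ∀ i, Measurable fun z : ℂ =>
      (closedBall (S.centre i) (S.radius i)).indicator (fun _ => ENNReal.ofReal (B i)) z :=
    fun i => measurable_const.indicator measurableSet_closedBall
  have hm' : ∀ i, Measurable fun z : ℂ => ENNReal.ofReal (((1 + ‖z - S.centre i‖) ^ 3)⁻¹) :=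
    fun i => by fun_prop
  rw [lintegral_add_left (Measurable.tsum hm)]
  refine add_le_add ?_ ?_
  · rw [lintegral_tsum fun i => (hm i).aemeasurable]
    refine ENNReal.tsum_le_tsum fun i => ?_
    rw [lintegral_indicator measurableSet_closedBall, setLIntegral_const,
      Measure.restrict_apply measurableSet_closedBall]
    split_ifs with h
    · by_cases hr : 0 ≤ S.radius i
      · have hvol : volume (closedBall (S.centre i) (S.radius i)) =
            ENNReal.ofReal (Real.pi * S.radius i ^ 2) := by
          rw [Complex.volume_closedBall, mul_comm, ENNReal.ofReal_mul Real.pi_pos.le,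
            ENNReal.ofReal_pow hr]
          congr 1
          exact (ENNReal.ofReal_coe_nnreal (p := NNReal.pi)).symm
        have hB0 : 0 ≤ B i :=
          le_trans (by have := Real.pi_pos; positivity) (hB i 0 (by simpa using hr))
        rw [ENNReal.ofReal_mul hB0, ← hvol]
        gcongr
        exact inter_subset_left
      · rw [closedBall_eq_empty.2 (not_le.1 hr)]
        simp
    · have : closedBall (S.centre i) (S.radius i) ∩ ball 0 r = ∅ := by
        refine eq_empty_of_forall_notMem fun w ⟨hw1, hw2⟩ => h ?_
        rw [mem_closedBall, dist_comm, dist_eq_norm] at hw1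
        rw [mem_ball_zero_iff] at hw2
        have := norm_sub_norm_le (S.centre i) w
        linarith
      rw [this]
      simp
  · refine (lintegral_mono' Measure.restrict_le_self le_rfl).trans_eq ?_
    rw [lintegral_tsum fun i => ((hm' i).const_mul _).aemeasurable]
    have : ∀ i, ∫⁻ z : ℂ, ENNReal.ofReal (τ / 2 / 2 ^ i) *
        ENNReal.ofReal (((1 + ‖z - S.centre i‖) ^ 3)⁻¹) = ENNReal.ofReal (τ / 2 / 2 ^ i) *
          ∫⁻ z : ℂ, ENNReal.ofReal (((1 + ‖z‖) ^ 3)⁻¹) := by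
      intro i
      rw [lintegral_const_mul _ (hm' i)]
      congr 1
      exact lintegral_sub_right_eq_self (fun z : ℂ => ENNReal.ofReal (((1 + ‖z‖) ^ 3)⁻¹)) _
    rw [tsum_congr this, ENNReal.tsum_mul_right, ← ENNReal.ofReal_tsum_of_nonneg
      (fun i => by positivity) (summable_geometric_two' τ), tsum_geometric_two']

end SparseFamily

/-! ### The characteristic function -/

theorem fsDensity_nonneg {n : ℕ} (h : EntireCurve n) (z : ℂ) : 0 ≤ fsDensity h z := by
  refine mul_nonneg (inv_nonneg.2 Real.pi_pos.le) (div_nonneg ?_ (by positivity))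
  rw [sub_nonneg, ← mul_pow]
  exact pow_le_pow_left₀ (norm_nonneg _) (norm_inner_le_norm _ _) 2

theorem area_le {n : ℕ} (h : EntireCurve n) {r M : ℝ} (hM : 0 ≤ M)
    (hle : ∫⁻ z in ball (0 : ℂ) r, ENNReal.ofReal (fsDensity h z) ≤ ENNReal.ofReal M) :
    ∫ z in ball (0 : ℂ) r, fsDensity h z ≤ M := by
  rw [integral_eq_lintegral_of_nonneg_ae (Eventually.of_forall fun z => fsDensity_nonneg h z)
    (continuous_fsDensity h).aestronglyMeasurable]
  exact ENNReal.toReal_le_of_le_ofReal hM hle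

/-- A bound `M` for the area over the disc of radius `r` gives the bound `M log r` for the
characteristic function. -/
theorem characteristic_le {n : ℕ} (h : EntireCurve n) {r M : ℝ} (hr : 1 ≤ r)
    (hle : ∀ t, 1 ≤ t → t ≤ r → ∫ z in ball (0 : ℂ) t, fsDensity h z ≤ M) :
    h.characteristic r ≤ M * Real.log r := by
  have hint : IntervalIntegrable (fun t : ℝ => M * t⁻¹) volume 1 r := by
    refine ContinuousOn.intervalIntegrable ?_
    rw [uIcc_of_le hr]
    exact continuousOn_const.mul (continuousOn_id.inv₀ fun t ht => by
      have := ht.1; simp only [id]; linarith)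
  have h1 := intervalIntegral.norm_integral_le_of_norm_le (f := fun t : ℝ =>
    (∫ z in ball (0 : ℂ) t, fsDensity h z) / t) hr (Eventually.of_forall fun t ht => ?_) hint
  · refine (le_abs_self _).trans (h1.trans_eq ?_)
    rw [intervalIntegral.integral_const_mul, integral_inv_of_pos one_pos (by linarith), div_one]
  · have ht0 : 0 < t := by have := ht.1; linarith
    rw [Real.norm_of_nonneg (div_nonneg (integral_nonneg fun z => fsDensity_nonneg h z) ht0.le),
      div_eq_mul_inv]
    exact mul_le_mul_of_nonneg_right (hle t ht.1.le ht.2) (by positivity)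

/-! ### Placing the centres -/

/-- Real numbers can be chosen so sparse that they exceed given thresholds and have given mutual
distances. -/
theorem exists_sparse_sequence (T : ℕ → ℝ) (d : ℕ → ℕ → ℝ) :
    ∃ x : ℕ → ℝ, (∀ k, T k ≤ x k) ∧ ∀ i j, i ≠ j → d i j ≤ |x i - x j| := by
  set Y : ℕ → ℝ := fun k => |T k| +
    ∑ i ∈ Finset.range (k + 1), ∑ j ∈ Finset.range (k + 1), |d i j| with hY
  have hsum0 : ∀ k, 0 ≤ ∑ i ∈ Finset.range (k + 1), ∑ j ∈ Finset.range (k + 1), |d i j| :=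
    fun k => Finset.sum_nonneg fun i _ => Finset.sum_nonneg fun j _ => abs_nonneg _
  have hY0 : ∀ k, 0 ≤ Y k := fun k => add_nonneg (abs_nonneg _) (hsum0 k)
  have hYd : ∀ k i j, i ≤ k → j ≤ k → d i j ≤ Y k := by
    intro k i j hi hj
    have h1 : |d i j| ≤ ∑ j ∈ Finset.range (k + 1), |d i j| :=
      Finset.single_le_sum (f := fun j => |d i j|) (fun _ _ => abs_nonneg _)
        (Finset.mem_range.2 (Nat.lt_succ_of_le hj))
    have h2 : ∑ j ∈ Finset.range (k + 1), |d i j| ≤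
        ∑ i ∈ Finset.range (k + 1), ∑ j ∈ Finset.range (k + 1), |d i j| :=
      Finset.single_le_sum (f := fun i => ∑ j ∈ Finset.range (k + 1), |d i j|)
        (fun _ _ => Finset.sum_nonneg fun _ _ => abs_nonneg _)
        (Finset.mem_range.2 (Nat.lt_succ_of_le hi))
    simp only [hY]
    linarith [le_abs_self (d i j), abs_nonneg (T k)]
  set x : ℕ → ℝ := fun k => ∑ i ∈ Finset.range (k + 1), Y i with hx
  have hmono : ∀ i k, i < k → Y k ≤ x k - x i := by
    intro i k hik
    have h1 : x i ≤ ∑ i ∈ Finset.range k, Y i :=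
      Finset.sum_le_sum_of_subset_of_nonneg
        (Finset.range_mono (Nat.succ_le_of_lt hik)) fun i _ _ => hY0 i
    have h2 : x k = ∑ i ∈ Finset.range k, Y i + Y k := Finset.sum_range_succ _ _
    linarith
  refine ⟨x, fun k => ?_, fun i j hij => ?_⟩
  · have h1 : Y k ≤ x k :=
      Finset.single_le_sum (f := Y) (fun i _ => hY0 i) (Finset.self_mem_range_succ k)
    have h2 : T k ≤ Y k := by
      have := hsum0 k
      simp only [hY]
      linarith [le_abs_self (T k)]
    exact h2.trans h1
  · rcases lt_or_gt_of_ne hij with h | h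
    · rw [abs_sub_comm]
      exact (hYd j i j h.le le_rfl).trans ((hmono i j h).trans (le_abs_self _))
    · exact (hYd i i j le_rfl h.le).trans ((hmono j i h).trans (le_abs_self _))

/-- Outside a large disc a decaying lift is as close to the base point as desired, and so small in
the `C¹` sense that the square of its derivative is dominated by `κ / (1 + |ζ|) ^ 3`. -/
theorem IsDecayingLift.exists_radius {n : ℕ} {F : ℂ → EuclideanSpace ℂ (Fin (n + 1))}
    (hF : IsDecayingLift F) {κ : ℝ} (hκ : 0 < κ) (ρ₀ : ℝ) :
    ∃ ρ, ρ₀ ≤ ρ ∧ ∀ ζ : ℂ, ρ ≤ ‖ζ‖ → F ζ 0 ≠ 0 ∧ ‖affinePart F ζ‖ ≤ κ ∧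
      ‖deriv (affinePart F) ζ‖ ≤ κ ∧ ‖deriv (affinePart F) ζ‖ ^ 2 ≤ κ * ((1 + ‖ζ‖) ^ 3)⁻¹ := by
  obtain ⟨C, hC0, hC⟩ := hF.exists_deriv_affinePart_le
  have h1 : ∀ᶠ ζ in cobounded ℂ, ‖affinePart F ζ‖ ≤ κ := by
    have := hF.tendsto_affinePart.norm
    rw [norm_zero] at this
    exact this.eventually_le_const hκ
  have hev : ∀ᶠ ζ : ℂ in cobounded ℂ, F ζ 0 ≠ 0 ∧ ‖affinePart F ζ‖ ≤ κ ∧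
      ‖deriv (affinePart F) ζ‖ ≤ κ ∧ ‖deriv (affinePart F) ζ‖ ^ 2 ≤ κ * ((1 + ‖ζ‖) ^ 3)⁻¹ := by
    filter_upwards [hF.eventually_ne_zero, h1, hC,
      eventually_cobounded_le_norm (E := ℂ) (max 1 (max (C / κ) (8 * C ^ 2 / κ)))] with ζ h2 h3 h4 h5
    have h6 : 1 ≤ ‖ζ‖ := (le_max_left _ _).trans h5
    have h7 : C ≤ ‖ζ‖ * κ :=
      (div_le_iff₀ hκ).1 ((le_max_left _ _).trans ((le_max_right _ _).trans h5))
    have h8 : 8 * C ^ 2 ≤ ‖ζ‖ * κ :=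
      (div_le_iff₀ hκ).1 ((le_max_right _ _).trans ((le_max_right _ _).trans h5))
    have h9 : (1 + ‖ζ‖) ^ 3 ≤ 8 * ‖ζ‖ ^ 3 := by
      calc (1 + ‖ζ‖) ^ 3 ≤ (2 * ‖ζ‖) ^ 3 := by gcongr; linarith
        _ = _ := by ring
    refine ⟨h2, h3, h4.trans ?_, ?_⟩
    · rw [div_le_iff₀ (by positivity)]
      nlinarith
    · calc ‖deriv (affinePart F) ζ‖ ^ 2 ≤ (C / ‖ζ‖ ^ 2) ^ 2 := by gcongr
        _ = 8 * C ^ 2 / ‖ζ‖ * (8 * ‖ζ‖ ^ 3)⁻¹ := by field_simp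
        _ ≤ κ * ((1 + ‖ζ‖) ^ 3)⁻¹ := by
          gcongr
          rw [div_le_iff₀ (by positivity)]
          linarith
  obtain ⟨ρ, -, hρ⟩ := (hasBasis_cobounded_norm (E := ℂ)).eventually_iff.1 hev
  exact ⟨max ρ₀ ρ, le_max_left _ _, fun ζ hζ => hρ ((le_max_right _ _).trans hζ)⟩

theorem IsDecayingLift.exists_density_bound {n : ℕ} {F : ℂ → EuclideanSpace ℂ (Fin (n + 1))}
    (hF : IsDecayingLift F) (ρ : ℝ) :
    ∃ B, 0 ≤ B ∧ ∀ ζ : ℂ, ‖ζ‖ ≤ ρ → (2 * (1 + ‖deriv F ζ‖ / ‖F ζ‖)) ^ 2 / Real.pi ≤ B := by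
  have hd : Continuous (deriv F) :=
    (hF.differentiable.contDiff (n := 1)).continuous_deriv le_rfl
  have hc : Continuous fun ζ => (2 * (1 + ‖deriv F ζ‖ / ‖F ζ‖)) ^ 2 / Real.pi := by
    have := hF.differentiable.continuous
    have h0 : ∀ ζ, ‖F ζ‖ ≠ 0 := fun ζ => norm_ne_zero_iff.2 (hF.ne_zero ζ)
    fun_prop (disch := assumption)
  obtain ⟨B, hB⟩ := (isCompact_closedBall (0 : ℂ) ρ).bddAbove_image hc.continuousOn
  refine ⟨max 0 B, le_max_left _ _, fun ζ hζ => le_trans (hB ⟨ζ, ?_, rfl⟩) (le_max_right _ _)⟩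
  simpa using hζ

/-- Given decaying lifts can be placed on given rays, beyond given thresholds, so that each curve is
disturbed by the others as little as desired and the area of the superposition over discs grows as
slowly as desired. -/
theorem exists_sparseFamily {n : ℕ} {F : ℕ → ℂ → EuclideanSpace ℂ (Fin (n + 1))}
    (hF : ∀ k, IsDecayingLift (F k)) {ω : ℕ → ℂ} (hω : ∀ k, ‖ω k‖ = 1) (ρ₀ D tol : ℕ → ℝ)
    (htol : ∀ k, 0 < tol k) {φ : ℝ → ℝ} (hφ : Tendsto φ atTop atTop) {η : ℝ} (hη : 0 < η)
    (hηφ : ∀ r, 1 ≤ r → η ≤ φ r) :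
    ∃ (S : SparseFamily n) (x : ℕ → ℝ), S.lift = F ∧ (∀ k, S.centre k = x k * ω k) ∧
      (∀ k, ρ₀ k ≤ S.radius k) ∧ (∀ k, D k < x k) ∧
      (∀ j z, ‖z - S.centre j‖ ≤ S.radius j → ‖S.tail j z‖ ≤ tol j) ∧
      ∀ r, 1 ≤ r → ∫⁻ z in ball (0 : ℂ) r, ENNReal.ofReal (fsDensity S.curve z) ≤
        ENNReal.ofReal (φ r) := by
  set I : ENNReal := ∫⁻ z : ℂ, ENNReal.ofReal (((1 + ‖z‖) ^ 3)⁻¹) with hI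
  have hItop : I ≠ ⊤ := lintegral_inv_one_add_norm_cube_lt_top.ne
  set τ : ℝ := η / (I.toReal + 1) with hτ
  have hI0 : 0 ≤ I.toReal := ENNReal.toReal_nonneg
  have hτ0 : 0 < τ := by positivity
  have hτI : ENNReal.ofReal τ * I ≤ ENNReal.ofReal η := by
    rw [← ENNReal.ofReal_toReal hItop, ← ENNReal.ofReal_mul hτ0.le]
    refine ENNReal.ofReal_le_ofReal ?_
    rw [hτ, div_mul_eq_mul_div, div_le_iff₀ (by positivity)]
    nlinarith
  set κ : ℕ → ℝ := fun i => min ((1 / 2) ^ i / 8) (τ / 2 / 2 ^ i / 4 ^ (i + 1)) with hκ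
  choose ρ hρ₀ hρ using fun k =>
    (hF k).exists_radius (κ := κ k) (by positivity) (max 0 (ρ₀ k))
  have hρ0 : ∀ k, 0 ≤ ρ k := fun k => (le_max_left _ _).trans (hρ₀ k)
  choose B hB0 hB using fun k => (hF k).exists_density_bound (ρ k)
  set b : ℕ → ℝ := fun i => B i * (Real.pi * ρ i ^ 2) with hb
  have hb0 : ∀ i, 0 ≤ b i := fun i =>
    mul_nonneg (hB0 i) (mul_nonneg Real.pi_pos.le (sq_nonneg _))
  -- Beyond `R k` the comparison function exceeds the area caused by the first `k + 1` curves.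
  choose R hR using fun k => eventually_atTop.1
    (hφ.eventually_ge_atTop (η + ∑ i ∈ Finset.range (k + 1), b i))
  have hM : ∀ i j, ∃ M, ∀ ζ : ℂ, M ≤ ‖ζ‖ → ‖affinePart (F i) ζ‖ ≤ (1 / 2) ^ i / 8 * tol j :=
    fun i j => by
      obtain ⟨M, -, hM⟩ := (hF i).exists_radius
        (by have := htol j; positivity : 0 < (1 / 2 : ℝ) ^ i / 8 * tol j) 0
      exact ⟨M, fun ζ hζ => (hM ζ hζ).2.1⟩
  choose M hM using hM
  obtain ⟨x, hxT, hxd⟩ := exists_sparse_sequence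
    (fun k => max (k + ρ k) (max (D k + 1) (R k + ρ k)))
    (fun i j => ρ j + max (ρ i + 1) (M i j))
  have hx1 : ∀ k, k + ρ k ≤ x k := fun k => (le_max_left _ _).trans (hxT k)
  have hx2 : ∀ k, D k + 1 ≤ x k := fun k =>
    ((le_max_left _ _).trans (le_max_right _ _)).trans (hxT k)
  have hx3 : ∀ k, R k + ρ k ≤ x k := fun k =>
    ((le_max_right _ _).trans (le_max_right _ _)).trans (hxT k)
  have hx0 : ∀ k, 0 ≤ x k := fun k =>
    (add_nonneg (Nat.cast_nonneg k) (hρ0 k)).trans (hx1 k)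
  have hnorm : ∀ k, ‖(x k : ℂ) * ω k‖ = x k := fun k => by simp [hω, abs_of_nonneg (hx0 k)]
  have hsep : ∀ i j z, i ≠ j → ‖z - x j * ω j‖ ≤ ρ j →
      max (ρ i + 1) (M i j) ≤ ‖z - x i * ω i‖ := by
    intro i j z hij hz
    have h1 : |x i - x j| ≤ ‖(x i : ℂ) * ω i - x j * ω j‖ := by
      have := abs_norm_sub_norm_le ((x i : ℂ) * ω i) (x j * ω j)
      rwa [hnorm, hnorm] at this
    have h2 : ‖(x i : ℂ) * ω i - x j * ω j‖ ≤ ‖z - x j * ω j‖ + ‖z - x i * ω i‖ := by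
      have : (x i : ℂ) * ω i - x j * ω j = (z - x j * ω j) - (z - x i * ω i) := by ring
      rw [this]
      exact norm_sub_le _ _
    have h3 := hxd i j hij
    linarith
  let S : SparseFamily n :=
    { lift := F
      centre := fun k => x k * ω k
      radius := ρ
      isDecayingLift := hF
      ne_zero := fun i ζ h => (hρ i ζ h).1
      norm_affinePart_le := fun i ζ h => (hρ i ζ h).2.1.trans (min_le_left _ _)
      norm_deriv_le := fun i ζ h => (hρ i ζ h).2.2.1.trans (min_le_left _ _)
      disjoint := fun i j z hij hz => by
        have := (le_max_left _ _).trans (hsep i j z hij hz)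
        linarith
      le_norm_centre := fun i => by
        rw [hnorm]
        exact hx1 i }
  refine ⟨S, x, rfl, fun _ => rfl, fun k => (le_max_right _ _).trans (hρ₀ k),
    fun k => by linarith [hx2 k], fun j z hz => ?_, fun r hr => ?_⟩
  · exact S.norm_tail_le_of_forall (fun i hij =>
      hM i j _ ((le_max_right _ _).trans (hsep i j z hij hz))) (htol j).le
  · refine (S.lintegral_fsDensity_le (B := B) (τ := τ) hB (fun i ζ hζ => ?_) hτ0.le r).trans ?_
    · have h1 := (hρ i ζ hζ).2.2.2
      have h2 : κ i * 4 ^ (i + 1) ≤ τ / 2 / 2 ^ i :=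
        (le_div_iff₀ (by positivity)).1 (min_le_right _ _)
      have h3 : 0 ≤ ((1 + ‖ζ‖) ^ 3)⁻¹ := by positivity
      calc _ ≤ 4 ^ (i + 1) * (κ i * ((1 + ‖ζ‖) ^ 3)⁻¹) := by gcongr
        _ = κ i * 4 ^ (i + 1) * ((1 + ‖ζ‖) ^ 3)⁻¹ := by ring
        _ ≤ _ := by gcongr
    · have h1 : ∑' i, (if ‖S.centre i‖ - S.radius i < r then ENNReal.ofReal (b i) else 0) ≤
          ENNReal.ofReal (φ r - η) := by
        refine tsum_ite_ofReal_le hb0 fun k hk => ?_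
        have h2 : R k ≤ r := by
          have h3 : ‖S.centre k‖ = x k := hnorm k
          have h4 := hx3 k
          rw [h3] at hk
          change x k - ρ k < r at hk
          linarith
        have h5 := hR k r h2
        linarith
      refine (add_le_add h1 hτI).trans_eq ?_
      rw [← ENNReal.ofReal_add (by linarith [hηφ r hr]) hη.le, sub_add_cancel]

/-! ### Universal curves of slow growth -/

theorem EntireCurve.nonempty (n : ℕ) : Nonempty (EntireCurve n) := by
  have h : baseVec n ≠ 0 := norm_ne_zero_iff.1 (by simp [norm_baseVec])
  exact ⟨⟨fun _ => Projectivization.mk ℂ (baseVec n) h, fun z =>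
    ⟨fun _ => baseVec n, analyticAt_const, Eventually.of_forall fun _ => ⟨h, rfl⟩⟩⟩⟩

/-- The superposition of shadowing curves, one for each target curve in a countable dense set, each
direction in `E` and each precision. -/
theorem exists_slow_curve {n : ℕ} (hn : 1 ≤ n) {φ : ℝ → ℝ} (hφ : Tendsto φ atTop atTop) {η : ℝ}
    (hη : 0 < η) (hηφ : ∀ r, 1 ≤ r → η ≤ φ r) {E : Set ℝ} (hE : E.Countable) (hE0 : E.Nonempty) :
    ∃ h : EntireCurve n,
      (∀ r, 1 ≤ r → ∫⁻ z in ball (0 : ℂ) r, ENNReal.ofReal (fsDensity h z) ≤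
        ENNReal.ofReal (φ r)) ∧
      ∀ (g : EntireCurve n) (K : Set ℂ), IsCompact K → ∀ ε > 0, ∀ θ ∈ E, ∀ t : ℝ, 0 < t →
        ∃ m : ℕ, 1 ≤ m ∧ ∀ z ∈ K,
          dist (h (z + m * (t * Complex.exp (θ * Complex.I)))) (g z) < ε := by
  obtain ⟨A, hAc, hA⟩ := EntireCurve.exists_countable_approximation n
  obtain ⟨g₀⟩ := EntireCurve.nonempty n
  obtain ⟨a₀, ha₀, -⟩ := hA g₀ ∅ isCompact_empty 1 one_pos
  have := hAc.to_subtype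
  have := hE.to_subtype
  have := hE0.to_subtype
  have : Nonempty A := ⟨⟨a₀, ha₀⟩⟩
  obtain ⟨task, htask⟩ := exists_surjective_nat (A × E × ℕ)
  set ω : ℕ → ℂ := fun k => Complex.exp (((task k).2.1 : ℝ) * Complex.I) with hω
  have hω1 : ∀ k, ‖ω k‖ = 1 := fun k => Complex.norm_exp_ofReal_mul_I _
  choose F hF D hD using fun k => (task k).1.1.exists_shadowing_lift hn (hω1 k)
    (K := (task k).2.2) (β := (task k).2.2 + 1) (ε := 1 / ((task k).2.2 + 1))
    (by positivity) (by positivity) (by positivity)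
  obtain ⟨S, x, rfl, hSc, hSρ, hSx, hStail, hSarea⟩ := exists_sparseFamily hF hω1
    (fun k => (task k).2.2 + D k) D (fun k => 1 / ((task k).2.2 + 1)) (fun k => by positivity)
    hφ hη hηφ
  refine ⟨S.curve, hSarea, fun g K hK ε hε θ hθ t ht => ?_⟩
  obtain ⟨f, hf, hfg⟩ := hA g K hK (ε / 2) (by positivity)
  obtain ⟨κ, hκ⟩ := hK.isBounded.subset_closedBall (0 : ℂ)
  obtain ⟨N, hN⟩ := exists_nat_ge (max κ (max t (6 / ε)))
  obtain ⟨k, hk⟩ := htask (⟨f, hf⟩, ⟨θ, hθ⟩, N)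
  have hNκ : κ ≤ N := (le_max_left _ _).trans hN
  have hNt : t ≤ N := ((le_max_left _ _).trans (le_max_right _ _)).trans hN
  have hNε : 6 / ε ≤ N := ((le_max_right _ _).trans (le_max_right _ _)).trans hN
  have hωk : ω k = Complex.exp (θ * Complex.I) := by simp only [hω, hk]
  have hDk := hD k
  have hSρk := hSρ k
  have hStailk := hStail k
  simp only [hk] at hDk hSρk hStailk
  obtain ⟨s, hsD, m, hm, hshadow⟩ := hDk t ht (by linarith) (x k)
  have hm0 : 0 < m := by
    have h1 : 0 < (m : ℝ) * t := by
      rw [← hm]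
      have := hSx k
      have := neg_abs_le s
      linarith
    exact_mod_cast pos_of_mul_pos_left h1 ht.le
  lift m to ℕ using hm0.le
  refine ⟨m, by exact_mod_cast hm0, fun z hz => ?_⟩
  have hzN : z ∈ closedBall (0 : ℂ) N := closedBall_subset_closedBall hNκ (hκ hz)
  set w : ℂ := z + m * (t * Complex.exp (θ * Complex.I)) with hw
  have hwc : w - S.centre k = z + s * ω k := by
    have hm' : (m : ℂ) * t = x k + s := by
      have : ((m : ℤ) : ℝ) * t = x k + s := hm.symm
      exact_mod_cast this
    rw [hw, hSc, ← hωk, ← mul_assoc, hm']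
    ring
  have hwk : ‖w - S.centre k‖ ≤ S.radius k := by
    rw [hwc]
    refine (norm_add_le _ _).trans (le_trans (add_le_add (mem_closedBall_zero_iff.1 hzN) ?_) hSρk)
    simpa [hω1] using hsD
  have h1 := S.dist_curve_le (S.mem_awayFrom_of_norm_le hwk)
  have h2 := hStailk w hwk
  have h3 := hshadow z hzN
  have h4 := hfg z hz
  simp only [hwc] at h1
  have h5 : 1 / ((N : ℝ) + 1) < ε / 6 := by
    rw [div_lt_div_iff₀ (by positivity) (by norm_num)]
    have := (div_le_iff₀ hε).1 hNε
    linarith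
  have h6 := dist_triangle4 (S.curve w) (Projectivization.mk ℂ (S.lift k (z + s * ω k))
    ((S.isDecayingLift k).ne_zero _)) (f z) (g z)
  rw [dist_comm] at h1
  linarith

theorem EntireCurve.isUniversal_of_approximation {n : ℕ} {h : EntireCurve n}
    (H : ∀ (g : EntireCurve n) (K : Set ℂ), IsCompact K → ∀ ε > 0, ∃ a : ℂ, ∀ z ∈ K,
      dist (h (z + a)) (g z) < ε) : h.IsUniversal := by
  intro g K hK
  choose a ha using fun i : ℕ => H g K hK (1 / ((i : ℝ) + 1)) (by positivity)
  refine ⟨a, Metric.tendstoUniformlyOn_iff.2 fun ε hε => ?_⟩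
  filter_upwards [tendsto_one_div_add_atTop_nhds_zero_nat.eventually_lt_const hε] with i hi z hz
  rw [dist_comm]
  exact (ha i z hz).trans hi

theorem exists_pos_le_of_tendsto_atTop {φ : ℝ → ℝ} (hφc : ContinuousOn φ (Ioi 0))
    (hφpos : ∀ r, 0 < r → 0 < φ r) (hφ : Tendsto φ atTop atTop) :
    ∃ η, 0 < η ∧ ∀ r, 1 ≤ r → η ≤ φ r := by
  obtain ⟨R, hR⟩ := eventually_atTop.1 (hφ.eventually_ge_atTop 1)
  have hsub : Icc 1 (max 1 R) ⊆ Ioi (0 : ℝ) := fun r hr => one_pos.trans_le hr.1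
  obtain ⟨r₀, hr₀, hmin⟩ := (isCompact_Icc (a := (1 : ℝ)) (b := max 1 R)).exists_isMinOn
    ⟨1, le_rfl, le_max_left _ _⟩ (hφc.mono hsub)
  refine ⟨min 1 (φ r₀), lt_min one_pos (hφpos _ (hsub hr₀)), fun r hr => ?_⟩
  rcases le_total r (max 1 R) with h | h
  · exact (min_le_right _ _).trans (hmin ⟨hr, h⟩)
  · exact (min_le_left _ _).trans (hR r ((le_max_right _ _).trans h))

end UniversalCurve

theorem theorem2 (n : ℕ) (hn : 1 ≤ n) (φ : ℝ → ℝ) (hφc : ContinuousOn φ (Set.Ioi 0))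
    (hφpos : ∀ r, 0 < r → 0 < φ r) (hφ : Filter.Tendsto φ Filter.atTop Filter.atTop)
    (E : Set ℝ) (hE : E ⊆ Set.Ico 0 (2 * Real.pi)) (hEc : E.Countable) :
    ∃ h : UniversalCurve.EntireCurve n,
      h.IsUniversal ∧
      (∀ r : ℝ, 1 ≤ r → h.characteristic r ≤ φ r * Real.log r) ∧
      ∀ a : ℂ, a ≠ 0 → (∃ θ ∈ E, a = (‖a‖ : ℂ) * Complex.exp ((θ : ℂ) * Complex.I)) →
        UniversalCurve.IsHypercyclicFor (UniversalCurve.translation a) h := by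
  obtain ⟨η, hη, hηφ⟩ := UniversalCurve.exists_pos_le_of_tendsto_atTop hφc hφpos hφ
  -- The direction `0` is added so that universality follows even when `E` is empty.
  obtain ⟨h, harea, happrox⟩ := UniversalCurve.exists_slow_curve hn hφ hη hηφ (hEc.insert 0)
    (Set.insert_nonempty 0 E)
  refine ⟨h, ?_, fun r hr => ?_, fun a ha ⟨θ, hθ, haθ⟩ => ?_⟩
  · refine UniversalCurve.EntireCurve.isUniversal_of_approximation fun g K hK ε hε => ?_
    obtain ⟨m, -, hm⟩ := happrox g K hK ε hε 0 (Set.mem_insert 0 E) 1 one_pos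
    exact ⟨_, hm⟩
  · refine UniversalCurve.characteristic_le h hr fun t _ htr => ?_
    refine UniversalCurve.area_le h (hη.le.trans (hηφ r hr)) (le_trans ?_ (harea r hr))
    exact MeasureTheory.lintegral_mono_set (Metric.ball_subset_ball htr)
  · refine UniversalCurve.EntireCurve.dense_of_approximation fun g K hK ε hε => ?_
    obtain ⟨m, hm1, hm⟩ := happrox g K hK ε hε θ (Set.mem_insert_of_mem 0 hθ) ‖a‖
      (norm_pos_iff.2 ha)
    refine ⟨_, ⟨m, hm1, rfl⟩, fun z hz => ?_⟩
    rw [UniversalCurve.translation_iterate]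
    have := hm z hz
    rwa [← haθ] at this
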